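/- Let $N\ge 1$ and $L\ge 0$ be integers, $\omega=e^{2\pi\sqrt{-1}/N}$, and let $X,Z$ be the operators on $\mathbb C^N=\bigoplus_{n\in\mathbb Z/N}\mathbb C|n\rangle$ with $X|n\rangle=|n+1\rangle$, $Z|n\rangle=\omega^n|n\rangle$. For arbitrary nonzero complex parameters $a,b,a',b',c$ put $$ \mathtt L(t)=\begin{pmatrix} 1-t\frac{c}{b'b}X & \left(\frac1b-\omega\frac{ac}{b'b}X\right)Z\\[2pt] -t\left(\frac1{b'}-\frac{a'c}{b'b}X\right)Z^{-1} & -t\frac1{b'b}+\omega\frac{a'ac}{b'b}X\end{pmatrix},\qquad t\in\mathbb C, $$ $$ q(t)=\frac{\omega c}{(b'b)^2}(ab-t)(a'b'-t),\qquad z(t)=q(t)^L . $$ Let $\mathtt L_\ell(t)$ be $\mathtt L(t)$ with its entries acting on the $\ell$-th factor of $\bigotimes^L\mathbb C^N$, let $\begin{pmatrix}A_L(t)&B_L(t)\\ C_L(t)&D_L(t)\end{pmatrix}=\mathtt L_1(t)\cdots\mathtt L_L(t)$ be the monodromy matrix, $\tau^{(2)}(t)=A_L(\omega t)+D_L(\omega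 t)$, and denote by $X$ also the spin-shift operator $\prod_\ell X_\ell$ on $\bigotimes^L\mathbb C^N$. For a family of operators $O(t)$ write $\langle O\rangle=\prod_{i=0}^{N-1}O(\omega^it)$. For $j\ge1$ the $j$-th fusion $\mathtt L$-operator $\mathtt L^{(j)}(t)$ is the $j\times j$ matrix of operators on $\mathbb C^N$ with entries $\mathtt L^{(j)}_{k,l}(t)=\langle e_k^*|\,\mathtt L(\omega^{j-2}t)\otimes_{aux}\cdots\otimes_{aux}\mathtt L(\omega t)\otimes_{aux}\mathtt L(t)\,|e_l\rangle$, $0\le k,l\le j-1$ (operators on $\mathbb C^N$ being multiplied in the displayed order), where, in the $(j-1)$-fold tensor power of the auxiliary space $\mathbb C^2$ with basis $\varepsilon_0,\varepsilon_1$, $e_l$ is $\binom{j-1}{l}^{-1}$ times the sum of the basis tensors having exactly $l$ factors $\varepsilon_1$, and $e_k^*$ is the sum of the dual basis tensors having exactly $k$ factors $\varepsilon_1^*$. Put $\tau^{(0)}(t)=0$ and, for $j\ge1$, $\tau^{(j)}(t)=\operatorname{tr}_{\mathbb C^j}\big(\mathtt L^{(j)}_1(\omega t)\cdots\mathtt L^{(j)}_L(\omega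 t)\big)$, where $\mathtt L^{(j)}_\ell$ is $\mathtt L^{(j)}$ at site $\ell$; for $j=2$ this is $\tau^{(2)}(t)$ above, and $\tau^{(1)}(t)=I$. Then for all $t\in\mathbb C$ the fusion relations $$ \tau^{(2)}(\omega^{j-1}t)\,\tau^{(j)}(t)=z(\omega^{j-1}t)\,X\,\tau^{(j-1)}(t)+\tau^{(j+1)}(t)\qquad(j\ge1) $$ hold; the operator $\langle A_L\rangle+\langle D_L\rangle$ is a scalar operator $u(t)I$, with $$ u(t)=\operatorname{tr}\,\mathcal L(t^N)^L,\qquad \mathcal L(t^N)=\frac1{b'^Nb^N}\begin{pmatrix} b'^Nb^N-c^Nt^N & b'^N-a^Nc^N\\ -(b^N-a'^Nc^N)t^N & a'^Na^Nc^N-t^N\end{pmatrix}; $$ and the boundary fusion relation holds: $$ \tau^{(N+1)}(t)=z(t)\,X\,\tau^{(N-1)}(\omega t)+u(t)\,I . $$ -/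

import Mathlib

noncomputable section

namespace GenTau

/-- The primitive `N`-th root of unity `exp (2 π i / N)`. -/
def om (N : ℕ) : ℂ := Complex.exp (2 * Real.pi * Complex.I / N)

/-- Operators on the quantum space of one site, with basis indexed by `ZMod N`
(columns are inputs, rows are outputs). -/
abbrev SiteOp (N : ℕ) : Type := Matrix (ZMod N) (ZMod N) ℂ

/-- Operators on the `L`-fold tensor power of the one-site space, with basis indexed by
the configurations `Fin L → ZMod N`. -/
abbrev ChainOp (N L : ℕ) : Type := Matrix (Fin L → ZMod N) (Fin L → ZMod N) ℂ

/-- The Weyl operator `X |n⟩ = |n + 1⟩`. -/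
def weylX (N : ℕ) : SiteOp N := fun m n => if m = n + 1 then 1 else 0

/-- The Weyl operator `Z |n⟩ = ω ^ n |n⟩`. -/
def weylZ (N : ℕ) : SiteOp N := Matrix.diagonal fun n => om N ^ n.val

/-- The parameters `(a, b, a', b', c)` of the `L`-operator. -/
structure Params where
  a : ℂ
  b : ℂ
  a' : ℂ
  b' : ℂ
  c : ℂ

section OneSite

variable (N : ℕ) [NeZero N] (P : Params)

/-- The `L`-operator: a `2 × 2` matrix whose entries are one-site operators. -/
def lop (t : ℂ) : Matrix (Fin 2) (Fin 2) (SiteOp N) :=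
  !![1 - (t * P.c / (P.b' * P.b)) • weylX N,
      ((1 / P.b) • (1 : SiteOp N) - (om N * P.a * P.c / (P.b' * P.b)) • weylX N) * weylZ N;
    (-t) • (((1 / P.b') • (1 : SiteOp N) - (P.a' * P.c / (P.b' * P.b)) • weylX N)
        * (weylZ N)⁻¹),
      (om N * P.a' * P.a * P.c / (P.b' * P.b)) • weylX N
        - (t / (P.b' * P.b)) • (1 : SiteOp N)]

/-- The scalar factor `q(t)` of the quantum determinant `det_q L(t) = q(t) X`. -/
def qdet (t : ℂ) : ℂ :=
  om N * P.c / (P.b' * P.b) ^ 2 * (P.a * P.b - t) * (P.a' * P.b' - t)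

/-- The classical `L`-operator (the matrix of averages of the entries of `L`), as a function of
`t`; it depends on `t ^ N` only. -/
def classicalL (t : ℂ) : Matrix (Fin 2) (Fin 2) ℂ :=
  (1 / (P.b' ^ N * P.b ^ N)) •
    !![P.b' ^ N * P.b ^ N - P.c ^ N * t ^ N, P.b' ^ N - P.a ^ N * P.c ^ N;
      -(P.b ^ N - P.a' ^ N * P.c ^ N) * t ^ N, P.a' ^ N * P.a ^ N * P.c ^ N - t ^ N]

/-- The number of indices equal to `1` in a multi-index `i`, i.e. the weight of the basis tensor
`e_{i 0} ⊗ ⋯ ⊗ e_{i (n - 1)}` of the `n`-fold tensor power of `ℂ²`. -/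
def weight {n : ℕ} (i : Fin n → Fin 2) : ℕ := (Finset.univ.filter fun m => i m = 1).card

/-- The `j`-th fusion `L`-operator: the compression of
`L(ω ^ (j - 2) t) ⊗_aux ⋯ ⊗_aux L(ω t) ⊗_aux L(t)` (entries multiplied in this order in the
quantum space) to the space of symmetric tensors in the `(j - 1)`-fold tensor power of the
auxiliary space `ℂ²`, in the basis
`e_l = (j - 1 choose l)⁻¹ ∑ (basis tensors of weight l)`, `0 ≤ l ≤ j - 1`,
with dual basis `e_k^* = ∑ (dual basis tensors of weight k)`. -/
def fusedL (j : ℕ) (t : ℂ) : Matrix (Fin j) (Fin j) (SiteOp N) := fun k l =>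
  ((Nat.choose (j - 1) l : ℂ))⁻¹ •
    ∑ i : Fin (j - 1) → Fin 2 with weight i = (k : ℕ),
      ∑ r : Fin (j - 1) → Fin 2 with weight r = (l : ℕ),
        (List.ofFn fun m : Fin (j - 1) =>
          lop N P (om N ^ (m.rev : ℕ) * t) (i m) (r m)).prod

end OneSite

section Chain

variable {N : ℕ} [NeZero N] {L : ℕ}

/-- The operator `O` acting on the `ℓ`-th tensor factor, and trivially on the others. -/
def site (ℓ : Fin L) (O : SiteOp N) : ChainOp N L := fun s s' =>
  if ∀ m, m ≠ ℓ → s m = s' m then O (s ℓ) (s' ℓ) else 0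

/-- The product `K_1 K_2 ⋯ K_L` of matrices in the auxiliary space, where `K_ℓ` is `K` with its
entries acting on site `ℓ`. -/
def chain (L : ℕ) {j : ℕ} (K : Matrix (Fin j) (Fin j) (SiteOp N)) :
    Matrix (Fin j) (Fin j) (ChainOp N L) :=
  (List.ofFn fun ℓ : Fin L => K.map (site ℓ)).prod

variable (N L)

/-- The spin-shift operator `X = ∏_ℓ X_ℓ`. -/
def shiftX : ChainOp N L := (List.ofFn fun ℓ : Fin L => site ℓ (weylX N)).prod

variable (P : Params)

/-- The monodromy matrix, with entries `A_L(t)`, `B_L(t)`, `C_L(t)`, `D_L(t)`. -/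
def monodromy (t : ℂ) : Matrix (Fin 2) (Fin 2) (ChainOp N L) := chain L (lop N P t)

/-- The `τ⁽²⁾`-matrix. -/
def tau2 (t : ℂ) : ChainOp N L := (monodromy N L P (om N * t)).trace

/-- The fusion matrices `τ⁽ʲ⁾(t)`. -/
def tau (j : ℕ) (t : ℂ) : ChainOp N L := (chain L (fusedL N P j (om N * t))).trace

/-- The average `⟨O⟩ = O(t) O(ω t) ⋯ O(ω ^ (N - 1) t)` of a family of operators. -/
def average (O : ℂ → ChainOp N L) (t : ℂ) : ChainOp N L :=
  (List.ofFn fun i : Fin N => O (om N ^ (i : ℕ) * t)).prod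

/-- `z(t) = q(t) ^ L`. -/
def zfun (t : ℂ) : ℂ := qdet N P t ^ L

/-- The scalar function `u(t)`: the trace of the `L`-th power of the classical `L`-operator. -/
def ufun (t : ℂ) : ℂ := (classicalL N P t ^ L).trace

end Chain

end GenTau

end

/-!
Write the `L`-operator as a `2 × 2` matrix acting on an auxiliary space and attach to it the
central indeterminate `x`: the row vector `(1, x) L(t) = (α(t), β(t))` consists of the generating
polynomials of its two columns (`colPoly`). All relations used below are relations between such
polynomials.

*Fusion.* The exchange relation `α(ω t) β(t) = β(ω t) α(t)`, with the quantum determinant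
`D(ω t) A(t) - C(ω t) B(t) = q(t) X` (`Exch`, `exch_lop`), says that the antisymmetric tensor
spans an invariant line. Hence column `l` of the fused operator has the generating polynomial
`α_{n-1} ⋯ α_l β_{l-1} ⋯ β_0` (`symCol`, `sum_tensor_eq_symCol`), fusion is multiplicative in
factors with commuting entries (`symMat_mul`), and it may therefore be performed on the monodromy
matrix of the chain (`homChain_symMat`). The fusion relation is the decomposition
`ℂ² ⊗ Symⁿ = Symⁿ⁺¹ ⊕ Q · Symⁿ⁻¹` read off on traces (`trace_mul_sum_symCol`).

*Boundary.* At one site `α(t) = 1 - t M` and `b β(t) = W - t y`, with `y` central. The operators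
`W`, `M` and `D = X⁻¹` satisfy three `ω`-oscillator relations, arranged cyclically (`Osc`,
`Weyl.osc`), and one cubic Casimir relation (`Weyl.casimir`). For a cycle of `N` factors these
give `D G_l - ω ^ l G_l D = (1 - ω ^ l) q(t) x G'_{l-1}`, where `G_l` is a column of the `N`-fold
fusion and `G'` the fusion of the inner `N - 2` factors (`Osc.D_mul_column`). Since the entry of
`G_l` at `x ^ k` has degree `l - k` in `Z` (`D_mul_coeff_symCol`), the left side multiplies it by
`1 - ω ^ k`, up to the factor `D`. So the fused operator of size `N + 1` is block triangular
(`blockTri_lop`): columns `0` and `N` vanish in the intermediate rows, the intermediate block is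
conjugate to `q(t) X` times the fused operator of size `N - 1`, and the remaining `2 × 2` block
consists of the averages of the entries of `L`, which are the scalars in the classical
`L`-operator (`prodDown_lop`). Block triangularity passes to the chain (`BlockTri.homChain`), and
the trace is the boundary relation.

*Averages.* The two diagonal corner entries of the same fused monodromy matrix are the products of
the `A_L(ω ^ i t)` and of the `D_L(ω ^ i t)` in descending order. These operators commute for
different arguments by the Yang–Baxter relation (`intertwine_lop`, `commute_monodromy`), so the
order is immaterial.
-/

noncomputable section

namespace GenTau

open Polynomial

/-! ### Symmetric fusion over a noncommutative ring -/

section Fusion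

variable {R : Type*} [Ring R]

/-- The generating polynomial of the `r`-th column of a `2 × 2` matrix `K` over `R`: the product of
the row vector `(1, x)` with `K`, where the indeterminate `x` is central. -/
def colPoly (K : Matrix (Fin 2) (Fin 2) R) (r : Fin 2) : R[X] := C (K 0 r) + C (K 1 r) * X

/-- The generating polynomial of column `l ≤ n` of the `n`-fold symmetric fusion of the matrices
`K (n - 1), …, K 0`: the product `α_{n-1} ⋯ α_l β_{l-1} ⋯ β_0` of the column polynomials
`α_m = colPoly (K m) 0` and `β_m = colPoly (K m) 1`. The values for `l > n` are irrelevant. -/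
def symCol (K : ℕ → Matrix (Fin 2) (Fin 2) R) : ℕ → ℕ → R[X]
  | 0, _ => 1
  | n + 1, l =>
    if l ≤ n then colPoly (K n) 0 * symCol K n l else colPoly (K n) 1 * symCol K n n

/-- The quadratic relations saying that the antisymmetric tensor is an eigenvector of
`K' ⊗ K`, with the quantum determinant `Q` as its eigenvalue. -/
structure Exch (K' K : Matrix (Fin 2) (Fin 2) R) (Q : R) : Prop where
  h00 : K' 0 0 * K 0 1 = K' 0 1 * K 0 0
  h11 : K' 1 0 * K 1 1 = K' 1 1 * K 1 0
  h01 : K' 0 0 * K 1 1 - K' 0 1 * K 1 0 = Q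
  h10 : K' 1 1 * K 0 0 - K' 1 0 * K 0 1 = Q

lemma coeff_colPoly_mul_zero (K : Matrix (Fin 2) (Fin 2) R) (r : Fin 2) (p : R[X]) :
    (colPoly K r * p).coeff 0 = K 0 r * p.coeff 0 := by
  simp [colPoly, add_mul, mul_assoc, X_mul]

lemma coeff_colPoly_mul_succ (K : Matrix (Fin 2) (Fin 2) R) (r : Fin 2) (p : R[X]) (k : ℕ) :
    (colPoly K r * p).coeff (k + 1) = K 0 r * p.coeff (k + 1) + K 1 r * p.coeff k := by
  rw [colPoly, add_mul, mul_assoc, X_mul, coeff_add, coeff_C_mul, coeff_C_mul, coeff_mul_X]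

lemma Exch.colPoly {K' K : Matrix (Fin 2) (Fin 2) R} {Q : R} (h : Exch K' K Q) :
    colPoly K' 0 * colPoly K 1 = colPoly K' 1 * colPoly K 0 := by
  have h1 : K' 0 0 * K 1 1 + K' 1 0 * K 0 1 = K' 0 1 * K 1 0 + K' 1 1 * K 0 0 := by
    have := h.h01.trans h.h10.symm
    rw [sub_eq_sub_iff_add_eq_add] at this
    rw [this, add_comm]
  have key : ∀ a b c d : R, (C a + C b * X) * (C c + C d * X) =
      C (a * c) + C (a * d + b * c) * X + C (b * d) * X ^ 2 := by
    intro a b c d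
    have hx : C b * X * C c = C b * C c * X := by rw [mul_assoc, X_mul_C, mul_assoc]
    have hx' : C b * X * (C d * X) = C b * C d * X ^ 2 := by
      rw [mul_assoc, ← mul_assoc X, X_mul_C, mul_assoc, mul_assoc, ← pow_two]
    rw [add_mul, mul_add, mul_add, hx, hx']
    simp only [C_mul, C_add]
    noncomm_ring
  simp only [GenTau.colPoly, key, h.h00, h.h11, h1]

variable {K : ℕ → Matrix (Fin 2) (Fin 2) R}

lemma symCol_succ_of_le {n l : ℕ} (h : l ≤ n) :
    symCol K (n + 1) l = colPoly (K n) 0 * symCol K n l := by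
  simp [symCol, h]

lemma symCol_succ_self (n : ℕ) :
    symCol K (n + 1) (n + 1) = colPoly (K n) 1 * symCol K n n := by
  simp [symCol]

lemma symCol_of_ge {n l : ℕ} (h : n ≤ l) : symCol K n l = symCol K n n := by
  cases n with
  | zero => simp [symCol]
  | succ n =>
    have : ¬ l ≤ n := by omega
    simp [symCol, this]

/-- By the exchange relations, the factor of type `β` may be put in front instead of behind the
factors of type `α`. -/
lemma symCol_succ_succ {Q : ℕ → R} (hK : ∀ m, Exch (K (m + 1)) (K m) (Q m)) (n : ℕ) :
    ∀ l, l ≤ n → symCol K (n + 1) (l + 1) = colPoly (K n) 1 * symCol K n l := by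
  induction n with
  | zero =>
    intro l hl
    obtain rfl : l = 0 := by omega
    exact symCol_succ_self 0
  | succ n ih =>
    intro l hl
    rcases hl.lt_or_eq with h | rfl
    · rw [symCol_succ_of_le (by omega), ih l (by omega), ← mul_assoc, (hK n).colPoly, mul_assoc,
        symCol_succ_of_le (n := n) (by omega)]
    · exact symCol_succ_self _

lemma coeff_symCol_of_lt (n : ℕ) : ∀ l k, n < k → (symCol K n l).coeff k = 0 := by
  induction n with
  | zero =>
    intro l k hk
    simp [symCol, coeff_one, hk.ne']
  | succ n ih =>
    intro l k hk
    obtain ⟨k, rfl⟩ : ∃ k', k = k' + 1 := ⟨k - 1, by omega⟩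
    simp only [symCol]
    split_ifs <;> rw [coeff_colPoly_mul_succ, ih _ _ (by omega), ih _ _ (by omega)] <;> simp

/-- The trace form of the decomposition `ℂ² ⊗ Symⁿ = Symⁿ⁺¹ ⊕ Q · Symⁿ⁻¹`. -/
lemma trace_mul_sum_symCol {Q : ℕ → R} (hK : ∀ m, Exch (K (m + 1)) (K m) (Q m)) (m : ℕ) :
    (K (m + 1) 0 0 + K (m + 1) 1 1) * ∑ l ∈ Finset.range (m + 2), (symCol K (m + 1) l).coeff l =
      Q m * ∑ l ∈ Finset.range (m + 1), (symCol K m l).coeff l +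
        ∑ l ∈ Finset.range (m + 3), (symCol K (m + 2) l).coeff l := by
  -- The quantum determinant enters through the relation `D' A - C' B = Q`.
  have hterm : ∀ k ∈ Finset.range (m + 1),
      K (m + 1) 1 1 * (symCol K (m + 1) k).coeff k =
        Q m * (symCol K m k).coeff k +
          K (m + 1) 1 0 * (symCol K (m + 1) (k + 1)).coeff k := by
    intro k hk
    rw [Finset.mem_range] at hk
    rw [symCol_succ_of_le (by omega), symCol_succ_succ hK m k (by omega), ← (hK m).h10]
    cases k with
    | zero =>
      rw [coeff_colPoly_mul_zero, coeff_colPoly_mul_zero]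
      noncomm_ring
    | succ k =>
      rw [coeff_colPoly_mul_succ, coeff_colPoly_mul_succ, mul_add, mul_add,
        ← mul_assoc _ (K m 1 1), (hK m).h11]
      noncomm_ring
  have hmid : ∀ k ∈ Finset.range (m + 1),
      (symCol K (m + 2) (k + 1)).coeff (k + 1) =
        K (m + 1) 0 0 * (symCol K (m + 1) (k + 1)).coeff (k + 1) +
          K (m + 1) 1 0 * (symCol K (m + 1) (k + 1)).coeff k := by
    intro k hk
    rw [Finset.mem_range] at hk
    rw [symCol_succ_of_le (by omega), coeff_colPoly_mul_succ]
  have h0 : (symCol K (m + 2) 0).coeff 0 = K (m + 1) 0 0 * (symCol K (m + 1) 0).coeff 0 := by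
    rw [symCol_succ_of_le (by omega), coeff_colPoly_mul_zero]
  have hl : (symCol K (m + 2) (m + 2)).coeff (m + 2) =
      K (m + 1) 1 1 * (symCol K (m + 1) (m + 1)).coeff (m + 1) := by
    rw [symCol_succ_self, coeff_colPoly_mul_succ, coeff_symCol_of_lt _ _ _ (by omega)]
    simp
  have hR : ∑ l ∈ Finset.range (m + 3), (symCol K (m + 2) l).coeff l =
      ∑ k ∈ Finset.range (m + 1), (symCol K (m + 2) (k + 1)).coeff (k + 1) +
        (symCol K (m + 2) 0).coeff 0 + (symCol K (m + 2) (m + 2)).coeff (m + 2) := by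
    rw [Finset.sum_range_succ, Finset.sum_range_succ']
  have hL : K (m + 1) 0 0 * ∑ l ∈ Finset.range (m + 2), (symCol K (m + 1) l).coeff l =
      ∑ k ∈ Finset.range (m + 1),
        K (m + 1) 0 0 * (symCol K (m + 1) (k + 1)).coeff (k + 1) +
        K (m + 1) 0 0 * (symCol K (m + 1) 0).coeff 0 := by
    rw [Finset.sum_range_succ', mul_add, Finset.mul_sum]
  have hL' : K (m + 1) 1 1 * ∑ l ∈ Finset.range (m + 2), (symCol K (m + 1) l).coeff l =
      Q m * ∑ l ∈ Finset.range (m + 1), (symCol K m l).coeff l +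
        ∑ k ∈ Finset.range (m + 1),
          K (m + 1) 1 0 * (symCol K (m + 1) (k + 1)).coeff k +
        K (m + 1) 1 1 * (symCol K (m + 1) (m + 1)).coeff (m + 1) := by
    rw [Finset.sum_range_succ, mul_add, Finset.mul_sum, Finset.mul_sum,
      Finset.sum_congr rfl hterm, Finset.sum_add_distrib]
  rw [add_mul, hR, hL, hL', h0, hl, Finset.sum_congr rfl hmid, Finset.sum_add_distrib]
  abel

lemma commute_C_symCol {a : R} (h : ∀ m i j, Commute a (K m i j)) (n : ℕ) :
    ∀ l, Commute (C a) (symCol K n l) := by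
  have hc : ∀ m r, Commute (C a) (colPoly (K m) r) := by
    intro m r
    have h' : ∀ i, Commute (C a) (C (K m i r)) := fun i => by
      show _ = _
      rw [← C_mul, ← C_mul, (h m i r).eq]
    exact (h' 0).add_right ((h' 1).mul_right (commute_X (C a)).symm)
  induction n with
  | zero => intro l; simp [symCol]
  | succ n ih =>
    intro l
    simp only [symCol]
    split_ifs
    · exact (hc n 0).mul_right (ih l)
    · exact (hc n 1).mul_right (ih n)

lemma colPoly_mul (K₁ K₂ : Matrix (Fin 2) (Fin 2) R) (r : Fin 2) :
    colPoly (K₁ * K₂) r = colPoly K₁ 0 * C (K₂ 0 r) + colPoly K₁ 1 * C (K₂ 1 r) := by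
  simp only [colPoly, Matrix.mul_apply, Fin.sum_univ_two, C_add, C_mul, add_mul, mul_assoc, X_mul_C]
  abel

/-- Symmetric fusion is multiplicative when the entries of the two factors commute. -/
lemma symCol_mul {K₁ K₂ : ℕ → Matrix (Fin 2) (Fin 2) R} {Q : ℕ → R}
    (hK : ∀ m, Exch (K₁ (m + 1)) (K₁ m) (Q m))
    (hc : ∀ m m' i j i' j', Commute (K₂ m i j) (K₁ m' i' j')) (n : ℕ) :
    ∀ l, symCol (fun m => K₁ m * K₂ m) n l =
      ∑ m ∈ Finset.range (n + 1), symCol K₁ n m * C ((symCol K₂ n l).coeff m) := by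
  induction n with
  | zero => intro l; simp [symCol]
  | succ n ih =>
    have step : ∀ r l, colPoly (K₁ n * K₂ n) r * symCol (fun m => K₁ m * K₂ m) n l =
        ∑ m ∈ Finset.range (n + 2),
          symCol K₁ (n + 1) m * C ((colPoly (K₂ n) r * symCol K₂ n l).coeff m) := by
      intro r l
      have hcC : ∀ i m, C (K₂ n i r) * symCol K₁ n m = symCol K₁ n m * C (K₂ n i r) :=
        fun i m => (commute_C_symCol (fun m' i' j' => hc n m' i r i' j') n m).eq
      have e1 : colPoly (K₁ n * K₂ n) r * symCol (fun m => K₁ m * K₂ m) n l =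
          ∑ m ∈ Finset.range (n + 1),
            (symCol K₁ (n + 1) m * C (K₂ n 0 r * (symCol K₂ n l).coeff m) +
            symCol K₁ (n + 1) (m + 1) * C (K₂ n 1 r * (symCol K₂ n l).coeff m)) := by
        rw [ih, colPoly_mul, Finset.mul_sum]
        refine Finset.sum_congr rfl fun m hm => ?_
        rw [Finset.mem_range] at hm
        rw [symCol_succ_of_le (by omega), symCol_succ_succ hK n m (by omega), add_mul,
          ← mul_assoc, ← mul_assoc, mul_assoc (colPoly (K₁ n) 0), mul_assoc (colPoly (K₁ n) 1),
          hcC, hcC, C_mul, C_mul]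
        simp only [mul_assoc]
      have e2 : ∑ m ∈ Finset.range (n + 1),
            symCol K₁ (n + 1) m * C (K₂ n 0 r * (symCol K₂ n l).coeff m) =
          ∑ m ∈ Finset.range (n + 2),
            symCol K₁ (n + 1) m * C (K₂ n 0 r * (symCol K₂ n l).coeff m) := by
        rw [Finset.sum_range_succ _ (n + 1), coeff_symCol_of_lt _ _ _ (Nat.lt_succ_self n)]
        simp
      rw [e1, Finset.sum_add_distrib, e2, Finset.sum_range_succ' _ (n + 1),
        Finset.sum_range_succ' _ (n + 1), coeff_colPoly_mul_zero]
      simp only [coeff_colPoly_mul_succ, C_add, mul_add, Finset.sum_add_distrib]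
      abel
    intro l
    by_cases h : l ≤ n
    · rw [symCol_succ_of_le h, step, symCol_succ_of_le h]
    · rw [symCol_of_ge (show n + 1 ≤ l by omega), symCol_of_ge (show n + 1 ≤ l by omega),
        symCol_succ_self, step, symCol_succ_self]

lemma weight_eq_sum {n : ℕ} (i : Fin n → Fin 2) : weight i = ∑ m, (i m : ℕ) := by
  rw [weight, Finset.card_filter]
  refine Finset.sum_congr rfl fun m _ => ?_
  generalize i m = a
  fin_cases a <;> simp

lemma weight_cons {n : ℕ} (a : Fin 2) (i : Fin n → Fin 2) :
    weight (Fin.cons a i : Fin (n + 1) → Fin 2) = a + weight i := by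
  simp [weight_eq_sum, Fin.sum_univ_succ]

lemma weight_le {n : ℕ} (i : Fin n → Fin 2) : weight i ≤ n := by
  simpa [weight] using Finset.card_filter_le (Finset.univ : Finset (Fin n)) (fun m => i m = 1)

lemma card_weight_eq (n l : ℕ) :
    (Finset.univ.filter fun r : Fin n → Fin 2 => weight r = l).card = n.choose l := by
  -- Compare coefficients in the generating function `∑ r, X ^ weight r = (1 + X) ^ n`.
  have h : ∑ r : Fin n → Fin 2, (X : ℕ[X]) ^ weight r = (1 + X) ^ n := by
    have := Finset.prod_univ_sum (fun _ : Fin n => (Finset.univ : Finset (Fin 2)))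
      (fun _ a => (X : ℕ[X]) ^ (a : ℕ))
    simp only [Fin.sum_univ_two, Finset.prod_const, Finset.card_univ, Fintype.card_fin,
      Fintype.piFinset_univ, Finset.prod_pow_eq_pow_sum] at this
    simp only [weight_eq_sum, ← this]
    simp
  have h2 := congrArg (fun p => p.coeff l) h
  simp only [finsetSum_coeff, coeff_X_pow, coeff_one_add_X_pow, Nat.cast_id] at h2
  rw [Finset.card_filter, ← h2]
  simp only [eq_comm]

/-- For every multi-index `r` of weight `l`, summing over all row multi-indices of the tensor
product of `K (n - 1), …, K 0` gives the same polynomial `symCol K n l`. -/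
lemma sum_tensor_eq_symCol {Q : ℕ → R} (hK : ∀ m, Exch (K (m + 1)) (K m) (Q m)) (n : ℕ) :
    ∀ r : Fin n → Fin 2, ∑ i : Fin n → Fin 2,
      C (List.ofFn fun m : Fin n => K (m.rev : ℕ) (i m) (r m)).prod * X ^ weight i =
        symCol K n (weight r) := by
  induction n with
  | zero => intro r; simp [symCol, weight]
  | succ n ih =>
    intro r
    obtain ⟨a, r, rfl⟩ : ∃ a r', r = Fin.cons a r' := ⟨r 0, Fin.tail r, by simp⟩
    rw [← (Fin.consEquiv (fun _ : Fin (n + 1) => Fin 2)).sum_comp, Fintype.sum_prod_type]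
    have e : ∀ b : Fin 2, ∑ i : Fin n → Fin 2,
        C (List.ofFn fun m : Fin (n + 1) => K (m.rev : ℕ)
          ((Fin.cons b i : Fin (n + 1) → Fin 2) m)
          ((Fin.cons a r : Fin (n + 1) → Fin 2) m)).prod *
            X ^ weight (Fin.cons b i : Fin (n + 1) → Fin 2) =
          C (K n b a) * X ^ (b : ℕ) * symCol K n (weight r) := by
      intro b
      rw [← ih r, Finset.mul_sum]
      refine Finset.sum_congr rfl fun i _ => ?_
      rw [weight_cons, List.ofFn_succ, List.prod_cons, C_mul, pow_add]
      simp only [Fin.cons_zero, Fin.cons_succ, Fin.rev_succ, Fin.val_castSucc, Fin.rev_zero,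
        Fin.val_last, mul_assoc]
      congr 1
      rw [← mul_assoc, ← mul_assoc, X_pow_mul]
    refine (Finset.sum_congr rfl fun b _ => e b).trans ?_
    rw [Fin.sum_univ_two]
    simp only [Fin.val_zero, Fin.val_one, pow_zero, pow_one, mul_one]
    rw [← add_mul, weight_cons]
    have hw := weight_le r
    change colPoly (K n) a * _ = _
    fin_cases a
    · simp only [Fin.zero_eta, zero_add]
      rw [symCol_succ_of_le hw]
    · simp only [Fin.mk_one, add_comm 1]
      rw [symCol_succ_succ hK n _ hw]

/-- The `n`-fold symmetric fusion of the matrices `K (n - 1), …, K 0`. -/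
def symMat (K : ℕ → Matrix (Fin 2) (Fin 2) R) (n : ℕ) : Matrix (Fin (n + 1)) (Fin (n + 1)) R :=
  fun k l => (symCol K n l).coeff k

lemma symMat_mul {K₁ K₂ : ℕ → Matrix (Fin 2) (Fin 2) R} {Q : ℕ → R}
    (hK : ∀ m, Exch (K₁ (m + 1)) (K₁ m) (Q m))
    (hc : ∀ m m' i j i' j', Commute (K₂ m i j) (K₁ m' i' j')) (n : ℕ) :
    symMat (fun m => K₁ m * K₂ m) n = symMat K₁ n * symMat K₂ n := by
  ext k l
  rw [Matrix.mul_apply]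
  simp only [symMat]
  rw [symCol_mul hK hc, finsetSum_coeff, Finset.sum_range]
  simp [coeff_mul_C]

lemma symMat_one (n : ℕ) : symMat (fun _ => (1 : Matrix (Fin 2) (Fin 2) R)) n = 1 := by
  have h : ∀ l, l ≤ n → symCol (fun _ => (1 : Matrix (Fin 2) (Fin 2) R)) n l = X ^ l := by
    induction n with
    | zero =>
      intro l hl
      obtain rfl : l = 0 := by omega
      simp [symCol]
    | succ n ih =>
      intro l hl
      rcases hl.lt_or_eq with h | rfl
      · rw [symCol_succ_of_le (by omega), ih l (by omega)]
        simp [colPoly]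
      · rw [symCol_succ_self, ih n le_rfl]
        simp [colPoly, pow_succ']
  ext k l
  rw [symMat, h l (by omega), coeff_X_pow, Matrix.one_apply]
  simp [Fin.ext_iff]

lemma symMat_map {S : Type*} [Ring S] (f : R →+* S) (K : ℕ → Matrix (Fin 2) (Fin 2) R) (n : ℕ) :
    symMat (fun m => (K m).map f) n = (symMat K n).map f := by
  have hc : ∀ m r, colPoly ((K m).map f) r = (colPoly (K m) r).map f := by
    intro m r
    simp [colPoly]
  have h : ∀ l, symCol (fun m => (K m).map f) n l = (symCol K n l).map f := by
    induction n with
    | zero => intro l; simp [symCol]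
    | succ n ih =>
      intro l
      simp only [symCol]
      split_ifs <;> simp [ih, hc, Polynomial.map_mul]
  ext k l
  simp [symMat, h]

lemma trace_symMat (K : ℕ → Matrix (Fin 2) (Fin 2) R) (n : ℕ) :
    (symMat K n).trace = ∑ l ∈ Finset.range (n + 1), (symCol K n l).coeff l := by
  simp [Matrix.trace, symMat, Finset.sum_range]

end Fusion

/-- By the exchange relations the sum defining an entry of the fused `L`-operator has equal terms
for all column multi-indices of the given weight, which cancels the binomial coefficient. -/
lemma fusedL_succ {N : ℕ} [NeZero N] {P : Params} {t : ℂ} {Q : ℕ → SiteOp N}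
    (hK : ∀ m : ℕ, Exch (lop N P (om N ^ (m + 1) * t)) (lop N P (om N ^ m * t)) (Q m)) (n : ℕ) :
    fusedL N P (n + 1) t = symMat (fun m => lop N P (om N ^ m * t)) n := by
  ext1 k l
  have h : ∀ r : Fin n → Fin 2, weight r = (l : ℕ) →
      ∑ i : Fin n → Fin 2 with weight i = (k : ℕ),
        (List.ofFn fun m : Fin n => lop N P (om N ^ (m.rev : ℕ) * t) (i m) (r m)).prod =
        symMat (fun m => lop N P (om N ^ m * t)) n k l := by
    intro r hr
    rw [symMat, ← hr, ← sum_tensor_eq_symCol (K := fun m => lop N P (om N ^ m * t)) hK,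
      finsetSum_coeff, Finset.sum_filter]
    simp only [coeff_C_mul_X_pow, eq_comm]
  have hne : ((n.choose l : ℕ) : ℂ) ≠ 0 := by
    exact_mod_cast (Nat.choose_pos (by omega)).ne'
  show ((n.choose l : ℂ))⁻¹ • ∑ i : Fin n → Fin 2 with weight i = (k : ℕ),
      ∑ r : Fin n → Fin 2 with weight r = (l : ℕ),
        (List.ofFn fun m : Fin n => lop N P (om N ^ (m.rev : ℕ) * t) (i m) (r m)).prod = _
  rw [Finset.sum_comm, Finset.sum_congr rfl fun r hr => h r (Finset.mem_filter.1 hr).2,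
    Finset.sum_const, card_weight_eq, ← Nat.cast_smul_eq_nsmul ℂ, smul_smul, inv_mul_cancel₀ hne,
    one_smul]

/-! ### Tensor products of matrices in the auxiliary space -/

section Products

variable {R : Type*} [Ring R]

lemma entry_mul_entry {K' K J' J : Matrix (Fin 2) (Fin 2) R}
    (hc : ∀ i j i' j', Commute (J' i j) (K i' j')) (p q r s : Fin 2) :
    (K' * J') p r * (K * J) q s =
      K' p 0 * K q 0 * (J' 0 r * J 0 s) + K' p 0 * K q 1 * (J' 0 r * J 1 s) +
      K' p 1 * K q 0 * (J' 1 r * J 0 s) + K' p 1 * K q 1 * (J' 1 r * J 1 s) := by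
  have h : ∀ i j, K' p i * J' i r * (K q j * J j s) = K' p i * K q j * (J' i r * J j s) := by
    intro i j
    rw [mul_assoc, ← mul_assoc (J' i r), (hc i r q j).eq]
    simp only [mul_assoc]
  simp only [Matrix.mul_apply, Fin.sum_univ_two, add_mul, mul_add, h]
  abel

lemma Exch.mul {K' K J' J : Matrix (Fin 2) (Fin 2) R} {Q Q' : R} (hK : Exch K' K Q)
    (hJ : Exch J' J Q') (hc : ∀ i j i' j', Commute (J' i j) (K i' j')) :
    Exch (K' * J') (K * J) (Q * Q') := by
  have h : ∀ p q, (K' * J') p 0 * (K * J) q 1 - (K' * J') p 1 * (K * J) q 0 =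
      (K' p 0 * K q 1 - K' p 1 * K q 0) * Q' := by
    intro p q
    rw [entry_mul_entry hc, entry_mul_entry hc]
    linear_combination (norm := noncomm_ring) K' p 0 * K q 0 * hJ.h00 + K' p 1 * K q 1 * hJ.h11 +
      K' p 0 * K q 1 * hJ.h01 - K' p 1 * K q 0 * hJ.h10
  constructor
  · rw [← sub_eq_zero, h, sub_eq_zero.2 hK.h00, zero_mul]
  · rw [← sub_eq_zero, h, sub_eq_zero.2 hK.h11, zero_mul]
  · rw [h, hK.h01]
  · rw [← neg_sub, h, ← hK.h10]
    noncomm_ring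

lemma Exch.one : Exch (1 : Matrix (Fin 2) (Fin 2) R) 1 1 := by
  constructor <;> simp

lemma Exch.map {S : Type*} [Ring S] (f : R →+* S) {K' K : Matrix (Fin 2) (Fin 2) R} {Q : R}
    (h : Exch K' K Q) : Exch (K'.map f) (K.map f) (f Q) := by
  constructor
  · simp only [Matrix.map_apply, ← map_mul, h.h00]
  · simp only [Matrix.map_apply, ← map_mul, h.h11]
  · simp only [Matrix.map_apply, ← map_mul, ← map_sub, h.h01]
  · simp only [Matrix.map_apply, ← map_mul, ← map_sub, h.h10]

/-- The tensor product, in the auxiliary space, of two `2 × 2` matrices over a ring `R`; the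
entries are multiplied in the displayed order. -/
def tens (K' K : Matrix (Fin 2) (Fin 2) R) : Matrix (Fin 2 × Fin 2) (Fin 2 × Fin 2) R :=
  fun p q => K' p.1 q.1 * K p.2 q.2

/-- Multiplicativity of the tensor product; the inner factors `J'` and `K` change places. -/
lemma tens_mul {K' K J' J : Matrix (Fin 2) (Fin 2) R}
    (hc : ∀ i j i' j', Commute (J' i j) (K i' j')) :
    tens (K' * J') (K * J) = tens K' K * tens J' J := by
  ext p q
  rw [Matrix.mul_apply, Fintype.sum_prod_type]
  simp only [tens, Fin.sum_univ_two]
  rw [entry_mul_entry hc]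
  abel

lemma tens_one : tens (1 : Matrix (Fin 2) (Fin 2) R) 1 = 1 := by
  ext ⟨p, p'⟩ ⟨q, q'⟩
  by_cases h : p = q <;> by_cases h' : p' = q' <;> simp [tens, Matrix.one_apply, h, h']

end Products

/-! ### Monodromy matrices of a list of commuting representations -/

section HomChain

variable {R S : Type*} [Ring R] [Ring S] [Algebra ℂ R] [Algebra ℂ S]

/-- The product of the images of a matrix `K` under a list of algebra homomorphisms. -/
def homChain (φs : List (R →ₐ[ℂ] S)) {j : ℕ} (K : Matrix (Fin j) (Fin j) R) :
    Matrix (Fin j) (Fin j) S :=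
  (φs.map fun φ : R →ₐ[ℂ] S => K.map φ).prod

/-- The homomorphisms in the list have pairwise commuting images. -/
def CommImages (φs : List (R →ₐ[ℂ] S)) : Prop :=
  φs.Pairwise fun φ ψ => ∀ a b, Commute (φ a) (ψ b)

variable {φs : List (R →ₐ[ℂ] S)}

lemma homChain_nil {j : ℕ} (K : Matrix (Fin j) (Fin j) R) :
    homChain ([] : List (R →ₐ[ℂ] S)) K = 1 := rfl

lemma homChain_cons (φ : R →ₐ[ℂ] S) {j : ℕ} (K : Matrix (Fin j) (Fin j) R) :
    homChain (φ :: φs) K = K.map φ * homChain φs K := by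
  simp [homChain]

lemma commute_homChain {x : S} (h : ∀ φ ∈ φs, ∀ a, Commute x (φ a)) {j : ℕ}
    (K : Matrix (Fin j) (Fin j) R) : ∀ i k, Commute x (homChain φs K i k) := by
  induction φs with
  | nil =>
    intro i k
    rw [homChain_nil, Matrix.one_apply]
    split_ifs
    · exact Commute.one_right x
    · exact Commute.zero_right x
  | cons φ φs ih =>
    intro i k
    rw [homChain_cons, Matrix.mul_apply]
    refine Commute.sum_right _ _ _ fun m _ => Commute.mul_right ?_ ?_
    · exact h φ (by simp) _
    · exact ih (fun ψ hψ => h ψ (by simp [hψ])) m k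

lemma exch_homChain (hφ : CommImages φs) {K' K : Matrix (Fin 2) (Fin 2) R} {Q : R}
    (h : Exch K' K Q) : Exch (homChain φs K') (homChain φs K) (φs.map fun φ => φ Q).prod := by
  induction φs with
  | nil => simpa [homChain_nil] using Exch.one
  | cons φ φs ih =>
    rw [CommImages, List.pairwise_cons] at hφ
    rw [homChain_cons, homChain_cons, List.map_cons, List.prod_cons]
    refine (h.map (φ : R →+* S)).mul (ih hφ.2) fun i j i' j' => ?_
    exact (commute_homChain (fun ψ hψ a => hφ.1 ψ hψ _ a) K' i j).symm

/-- Fusion and taking the monodromy matrix of a chain commute. -/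
lemma homChain_symMat (hφ : CommImages φs) {K : ℕ → Matrix (Fin 2) (Fin 2) R} {Q : ℕ → R}
    (hK : ∀ m, Exch (K (m + 1)) (K m) (Q m)) (n : ℕ) :
    homChain φs (symMat K n) = symMat (fun m => homChain φs (K m)) n := by
  induction φs with
  | nil => simp [homChain_nil, symMat_one]
  | cons φ φs ih =>
    rw [CommImages, List.pairwise_cons] at hφ
    have h1 : ∀ m, Exch ((K (m + 1)).map φ) ((K m).map φ) (φ (Q m)) :=
      fun m => (hK m).map (φ : R →+* S)
    have h2 : (symMat K n).map φ = symMat (fun m => (K m).map φ) n :=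
      (symMat_map (φ : R →+* S) K n).symm
    simp only [homChain_cons]
    rw [ih hφ.2, h2, ← symMat_mul h1]
    intro m m' i j i' j'
    exact (commute_homChain (fun ψ hψ a => hφ.1 ψ hψ _ a) (K m) i j).symm

/-- Intertwining relations between the two orders of a tensor product pass from the factors to the
monodromy matrix. -/
lemma intertwine_homChain (hφ : CommImages φs) {K' K : Matrix (Fin 2) (Fin 2) R}
    {A : Matrix (Fin 2 × Fin 2) (Fin 2 × Fin 2) ℂ}
    (h : A.map (algebraMap ℂ R) * tens K' K = tens K K' * A.map (algebraMap ℂ R)) :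
    A.map (algebraMap ℂ S) * tens (homChain φs K') (homChain φs K) =
      tens (homChain φs K) (homChain φs K') * A.map (algebraMap ℂ S) := by
  induction φs with
  | nil => simp [homChain_nil, tens_one]
  | cons φ φs ih =>
    rw [CommImages, List.pairwise_cons] at hφ
    have hc : ∀ K K' : Matrix (Fin 2) (Fin 2) R, ∀ i j i' j',
        Commute (homChain φs K i j) ((K'.map φ) i' j') := fun K K' i j i' j' =>
      (commute_homChain (fun ψ hψ a => hφ.1 ψ hψ _ a) K i j).symm
    have ht : ∀ K K' : Matrix (Fin 2) (Fin 2) R,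
        tens (K.map φ) (K'.map φ) = (tens K K').map φ := by
      intro K K'
      ext p q
      simp [tens]
    have hA : A.map (algebraMap ℂ S) = (A.map (algebraMap ℂ R)).map φ := by
      ext p q
      simp
    rw [homChain_cons, homChain_cons, tens_mul (hc _ _), tens_mul (hc _ _), ← mul_assoc, ht, ht,
      mul_assoc (Matrix.map _ _) _ (A.map _), ← ih hφ.2, ← mul_assoc, hA]
    congr 1
    have := congrArg (fun B => (φ : R →+* S).mapMatrix B) h
    rw [map_mul, map_mul] at this
    exact this

/-- The inclusion of the two extreme indices of `Fin (M + 2)`. -/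
def ends (M : ℕ) (i : Fin 2) : Fin (M + 2) := if i = 0 then 0 else Fin.last (M + 1)

/-- The inclusion of the intermediate indices of `Fin (M + 2)`. -/
def mid {M : ℕ} (k : Fin M) : Fin (M + 2) := k.castSucc.succ

lemma sum_ends_mid {M : ℕ} {T : Type*} [AddCommMonoid T] (f : Fin (M + 2) → T) :
    ∑ i, f i = (f (ends M 0) + f (ends M 1)) + ∑ k, f (mid k) := by
  rw [Fin.sum_univ_succ, Fin.sum_univ_castSucc]
  simp only [ends, mid, if_true, one_ne_zero, if_false, Fin.succ_last]
  abel

lemma mid_ne_ends {M : ℕ} (k : Fin M) (i : Fin 2) : mid k ≠ ends M i := by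
  intro h
  have h' := congrArg Fin.val h
  have := k.isLt
  fin_cases i
  · simp [mid, ends] at h'
  · simp [mid, ends] at h'; omega

lemma mid_inj {M : ℕ} {k l : Fin M} : mid k = mid l ↔ k = l := by
  simp [mid]

lemma ends_inj {M : ℕ} {i j : Fin 2} : ends M i = ends M j ↔ i = j := by
  fin_cases i <;> fin_cases j <;> simp [ends, Fin.ext_iff]

/-- A matrix `F` over a `ℂ`-algebra which is block triangular for the decomposition of its indices
into the two extreme ones and the intermediate ones: its extreme block is the scalar matrix `E`,
and its intermediate block is conjugate, by the diagonal matrix of the `c k`, to `Q • F'`. -/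
structure BlockTri {M : ℕ} (F : Matrix (Fin (M + 2)) (Fin (M + 2)) S)
    (F' : Matrix (Fin M) (Fin M) S) (c : Fin M → ℂ) (Q : S) (E : Matrix (Fin 2) (Fin 2) ℂ) :
    Prop where
  mid_ends : ∀ k i, F (mid k) (ends M i) = 0
  ends_ends : ∀ i j, F (ends M i) (ends M j) = algebraMap ℂ S (E i j)
  mid_mid : ∀ k l, F (mid k) (mid l) = ((c k)⁻¹ * c l) • (Q * F' k l)

lemma BlockTri.one {M : ℕ} {c : Fin M → ℂ} (hcz : ∀ k, c k ≠ 0) :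
    BlockTri (1 : Matrix (Fin (M + 2)) (Fin (M + 2)) S) 1 c 1 1 where
  mid_ends k i := by rw [Matrix.one_apply_ne (mid_ne_ends k i)]
  ends_ends i j := by
    simp only [Matrix.one_apply, ends_inj]
    split_ifs <;> simp
  mid_mid k l := by
    simp only [Matrix.one_apply, mid_inj]
    split_ifs with h
    · subst h
      simp [hcz k]
    · simp

lemma BlockTri.mul {M : ℕ} {F G : Matrix (Fin (M + 2)) (Fin (M + 2)) S}
    {F' G' : Matrix (Fin M) (Fin M) S} {c : Fin M → ℂ} {Q Q' : S}
    {E E' : Matrix (Fin 2) (Fin 2) ℂ} (hcz : ∀ k, c k ≠ 0) (hF : BlockTri F F' c Q E)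
    (hG : BlockTri G G' c Q' E') (hQ : ∀ k l, Commute Q' (F' k l)) :
    BlockTri (F * G) (F' * G') c (Q * Q') (E * E') where
  mid_ends k i := by
    rw [Matrix.mul_apply, sum_ends_mid]
    simp [hF.mid_ends, hG.mid_ends]
  ends_ends i j := by
    rw [Matrix.mul_apply, sum_ends_mid, Matrix.mul_apply, Fin.sum_univ_two]
    simp [hF.ends_ends, hG.ends_ends, hG.mid_ends]
  mid_mid k l := by
    rw [Matrix.mul_apply, sum_ends_mid, Matrix.mul_apply, Finset.mul_sum, Finset.smul_sum]
    simp only [hF.mid_ends, zero_mul, add_zero, zero_add]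
    refine Finset.sum_congr rfl fun m _ => ?_
    rw [hF.mid_mid, hG.mid_mid, smul_mul_smul_comm, mul_assoc Q, ← mul_assoc (F' k m),
      ← (hQ k m).eq]
    simp only [mul_assoc]
    rw [mul_inv_cancel_left₀ (hcz m)]

lemma BlockTri.map {M : ℕ} {F : Matrix (Fin (M + 2)) (Fin (M + 2)) R}
    {F' : Matrix (Fin M) (Fin M) R} {c : Fin M → ℂ} {Q : R} {E : Matrix (Fin 2) (Fin 2) ℂ}
    (hF : BlockTri F F' c Q E) (φ : R →ₐ[ℂ] S) :
    BlockTri (F.map φ) (F'.map φ) c (φ Q) E where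
  mid_ends k i := by simp [hF.mid_ends]
  ends_ends i j := by simp [hF.ends_ends]
  mid_mid k l := by simp [hF.mid_mid]

lemma BlockTri.homChain (hφ : CommImages φs) {M : ℕ} {F : Matrix (Fin (M + 2)) (Fin (M + 2)) R}
    {F' : Matrix (Fin M) (Fin M) R} {c : Fin M → ℂ} {Q : R} {E : Matrix (Fin 2) (Fin 2) ℂ}
    (hcz : ∀ k, c k ≠ 0) (hF : BlockTri F F' c Q E) :
    BlockTri (homChain φs F) (homChain φs F') c (φs.map fun φ => φ Q).prod
      (E ^ φs.length) := by
  induction φs with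
  | nil => simpa [homChain_nil] using BlockTri.one hcz
  | cons φ φs ih =>
    rw [CommImages, List.pairwise_cons] at hφ
    rw [homChain_cons, homChain_cons, List.map_cons, List.prod_cons, List.length_cons, pow_succ']
    refine (hF.map φ).mul hcz (ih hφ.2) fun k l => (Commute.list_prod_right _ _ ?_).symm
    intro x hx
    obtain ⟨ψ, hψ, rfl⟩ := List.mem_map.1 hx
    exact hφ.1 ψ hψ _ _

/-- The conjugation by the diagonal matrix of the `c k` does not affect the trace. -/
lemma BlockTri.trace {M : ℕ} {F : Matrix (Fin (M + 2)) (Fin (M + 2)) S}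
    {F' : Matrix (Fin M) (Fin M) S} {c : Fin M → ℂ} {Q : S} {E : Matrix (Fin 2) (Fin 2) ℂ}
    (hcz : ∀ k, c k ≠ 0) (hF : BlockTri F F' c Q E) :
    F.trace = Q * F'.trace + E.trace • (1 : S) := by
  rw [Matrix.trace, sum_ends_mid, add_comm, Matrix.trace_fin_two, Matrix.trace, Finset.mul_sum]
  simp only [Matrix.diag_apply, hF.mid_mid, hF.ends_ends, inv_mul_cancel₀ (hcz _), one_smul,
    Algebra.algebraMap_eq_smul_one, add_smul]

end HomChain

/-! ### One-site operators in the chain -/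

section Site

lemma site_apply_update {N L : ℕ} (ℓ : Fin L) (O : SiteOp N) (s s' : Fin L → ZMod N) (x : ZMod N) :
    site ℓ O (Function.update s ℓ x) s' = if ∀ m, m ≠ ℓ → s m = s' m then O x (s' ℓ) else 0 := by
  have : (∀ m, m ≠ ℓ → Function.update s ℓ x m = s' m) ↔ ∀ m, m ≠ ℓ → s m = s' m := by
    refine forall₂_congr fun m hm => ?_
    rw [Function.update_of_ne hm]
  simp only [site, this, Function.update_self]

variable {N : ℕ} [NeZero N] {L : ℕ}

lemma site_mul_apply (ℓ : Fin L) (O : SiteOp N) (A : ChainOp N L) (s s' : Fin L → ZMod N) :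
    (site ℓ O * A) s s' = ∑ x, O (s ℓ) x * A (Function.update s ℓ x) s' := by
  rw [Matrix.mul_apply]
  symm
  refine Fintype.sum_of_injective (fun x => Function.update s ℓ x)
    (Function.update_injective s ℓ) _ _ ?_ ?_
  · intro u hu
    rw [site, if_neg, zero_mul]
    intro h
    refine hu ⟨u ℓ, ?_⟩
    ext m
    by_cases hm : m = ℓ
    · subst hm; simp
    · simp [hm, h m hm]
  · intro x
    have : ∀ m, m ≠ ℓ → s m = Function.update s ℓ x m := fun m hm => by simp [hm]
    simp only [site, if_pos this, Function.update_self]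

/-- The embedding of the one-site operators at site `ℓ`, as an algebra homomorphism. -/
def siteHom (ℓ : Fin L) : SiteOp N →ₐ[ℂ] ChainOp N L :=
  AlgHom.ofLinearMap
    { toFun := site ℓ
      map_add' := fun O O' => by
        ext s s'
        simp only [site, Matrix.add_apply]
        split_ifs <;> simp
      map_smul' := fun c O => by
        ext s s'
        simp [site] }
    (by
      ext s s'
      simp only [LinearMap.coe_mk, AddHom.coe_mk, site, Matrix.one_apply]
      by_cases h : s = s'
      · subst h; simp
      · rw [if_neg h]
        split_ifs with h1 h2
        · refine absurd (funext fun m => ?_) h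
          by_cases hm : m = ℓ
          · rw [hm, h2]
          · exact h1 m hm
        · rfl
        · rfl)
    (by
      intro O O'
      ext s s'
      simp only [LinearMap.coe_mk, AddHom.coe_mk]
      rw [site_mul_apply]
      simp only [site_apply_update]
      rw [site]
      split_ifs
      · rw [Matrix.mul_apply]
      · simp)

lemma commute_site {ℓ k : Fin L} (h : ℓ ≠ k) (O O' : SiteOp N) :
    Commute (site ℓ O) (site k O') := by
  have key : ∀ {ℓ k : Fin L} (_ : ℓ ≠ k) (O O' : SiteOp N) (s s' : Fin L → ZMod N),
      (site ℓ O * site k O') s s' = if ∀ m, m ≠ ℓ → m ≠ k → s m = s' m then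
        O (s ℓ) (s' ℓ) * O' (s k) (s' k) else 0 := by
    intro ℓ k h O O' s s'
    rw [site_mul_apply, Finset.sum_eq_single (s' ℓ)]
    · have : (∀ m, m ≠ k → Function.update s ℓ (s' ℓ) m = s' m) ↔
          ∀ m, m ≠ ℓ → m ≠ k → s m = s' m := by
        constructor
        · intro H m h1 h2
          simpa [h1] using H m h2
        · intro H m h2
          by_cases h1 : m = ℓ
          · subst h1; simp
          · simpa [h1] using H m h1 h2
      simp only [site, this, Function.update_of_ne h.symm]
      split_ifs <;> simp
    · intro x _ hx
      rw [site, if_neg, mul_zero]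
      intro H
      exact hx (by simpa using H ℓ h)
    · simp
  ext s s'
  rw [key h, key h.symm]
  simp only [mul_comm]
  congr 1
  exact propext ⟨fun H m h1 h2 => H m h2 h1, fun H m h1 h2 => H m h2 h1⟩

variable (N L)

/-- The list of the embeddings at the sites `1, …, L`. -/
def siteHoms : List (SiteOp N →ₐ[ℂ] ChainOp N L) := List.ofFn siteHom

lemma commImages_siteHoms : CommImages (siteHoms N L) := by
  rw [CommImages, siteHoms, List.pairwise_ofFn]
  exact fun i j hij a b => commute_site hij.ne a b

lemma length_siteHoms : (siteHoms N L).length = L := List.length_ofFn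

lemma chain_eq_homChain {j : ℕ} (K : Matrix (Fin j) (Fin j) (SiteOp N)) :
    chain L K = homChain (siteHoms N L) K := by
  rw [chain, homChain, siteHoms, List.map_ofFn]
  rfl

lemma prod_siteHoms (c : ℂ) :
    ((siteHoms N L).map fun φ => φ (c • weylX N)).prod = c ^ L • shiftX N L := by
  have h : ∀ φs : List (SiteOp N →ₐ[ℂ] ChainOp N L),
      (φs.map fun φ => φ (c • weylX N)).prod =
        c ^ φs.length • (φs.map fun φ => φ (weylX N)).prod := by
    intro φs
    induction φs with
    | nil => simp
    | cons φ φs ih =>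
      rw [List.map_cons, List.prod_cons, ih, map_smul, List.map_cons, List.prod_cons,
        smul_mul_smul_comm, List.length_cons, pow_succ']
  rw [h, length_siteHoms, shiftX]
  change _ • (List.map _ (List.ofFn siteHom)).prod = _
  rw [List.map_ofFn]
  rfl

end Site

/-! ### Products over geometric progressions -/

section QProd

variable {k A : Type*} [CommRing k] [Ring A] [Algebra k A]

/-- The product `(U - w ^ (n - 1) V) ⋯ (U - w V) (U - V)`. -/
def qprod (w : k) (U V : A) : ℕ → A
  | 0 => 1
  | n + 1 => (U - w ^ n • V) * qprod w U V n

lemma commute_qprod {w : k} {U V z : A} (hU : Commute z U) (hV : Commute z V) (n : ℕ) :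
    Commute z (qprod w U V n) := by
  induction n with
  | zero => exact Commute.one_right z
  | succ n ih => exact (hU.sub_right (hV.smul_right _)).mul_right ih

lemma qprod_succ_right {w : k} {U V : A} (n : ℕ) :
    qprod w U V (n + 1) = qprod w U (w • V) n * (U - V) := by
  induction n with
  | zero => simp [qprod]
  | succ n ih =>
    rw [qprod, ih, qprod, smul_smul, ← pow_succ, mul_assoc]

lemma qprod_succ_left {w : k} {U V : A} (h : Commute U V) (n : ℕ) :
    qprod w U V (n + 1) = (U - V) * qprod w U (w • V) n := by
  rw [qprod_succ_right]
  refine (commute_qprod ?_ ?_ n).eq.symm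
  · exact (Commute.refl U).sub_left h.symm
  · exact (h.sub_left (Commute.refl V)).smul_right _

/-- Collecting the powers of `Z` on the right multiplies `V` by successive powers of `w`. -/
lemma sub_mul_pow_eq_qprod {w : k} {U V Z : A} (h : Commute U V) (hU : Z * U = U * Z)
    (hV : Z * V = w • (V * Z)) (n : ℕ) : ((U - V) * Z) ^ n = qprod w U V n * Z ^ n := by
  induction n with
  | zero => simp [qprod]
  | succ n ih =>
    have hq : ∀ m, Z * qprod w U V m = qprod w U (w • V) m * Z := by
      intro m
      induction m with
      | zero => simp [qprod]
      | succ m ihm =>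
        rw [qprod, ← mul_assoc, qprod, mul_assoc _ _ Z, ← ihm, ← mul_assoc, mul_sub, sub_mul,
          hU, mul_smul_comm, hV, smul_mul_assoc, smul_mul_assoc, sub_mul, sub_mul, smul_mul_assoc,
          smul_mul_assoc, smul_mul_assoc, smul_mul_assoc]
    rw [pow_succ', ih, qprod_succ_left h, pow_succ' Z]
    simp only [mul_assoc]
    rw [← mul_assoc Z, hq, mul_assoc]

end QProd

/-! ### Three cyclically arranged oscillator relations -/

section Oscillator

variable {k A : Type*} [CommRing k] [Ring A] [Algebra k A]

/-- Three elements `W`, `M`, `D` of an algebra, each consecutive pair of which (in the cyclic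
order) obeys a `w`-oscillator relation. -/
structure Osc (w y κ e : k) (W M D : A) : Prop where
  WM : W * M = w • (M * W) + ((1 - w) * y) • (1 : A)
  MD : M * D = w • (D * M) + ((1 - w) * κ) • (1 : A)
  DW : D * W = w • (W * D) + ((1 - w) * e) • (1 : A)

variable {w w' y κ e : k} {W M D : A}

lemma Osc.D_mul_factor (h : Osc w y κ e W M D) (s : k) :
    D * (1 - (w * s) • M) = (1 - s • M) * D + (s * (1 - w) * κ) • (1 : A) := by
  rw [mul_sub, sub_mul, smul_mul_assoc, h.MD, mul_smul_comm]
  simp only [mul_one, one_mul]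
  module

/-- The operator `D` acts on products of factors `1 - t M` as a `w`-difference operator. -/
lemma Osc.D_mul_qprod_M (h : Osc w y κ e W M D) (s : k) (p : ℕ) :
    D * qprod w 1 ((w * s) • M) (p + 1) =
      qprod w 1 ((w * s) • M) p * ((1 - s • M) * D + (κ * s * (1 - w ^ (p + 1))) • (1 : A)) := by
  induction p with
  | zero =>
    simp only [qprod, pow_zero, one_smul, mul_one, one_mul, zero_add, pow_one]
    rw [h.D_mul_factor]
    module
  | succ p ih =>
    have e1 : w ^ (p + 1) • (w * s) • M = (w * (w ^ (p + 1) * s)) • M := by module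
    have e2 : (1 : A) - (w ^ (p + 1) * s) • M = 1 - w ^ p • (w * s) • M := by module
    rw [qprod, e1, ← mul_assoc, h.D_mul_factor, add_mul, mul_assoc, ih, e2, ← mul_assoc, ← qprod,
      smul_mul_assoc, one_mul, mul_add, mul_add]
    simp only [mul_smul_comm, mul_one]
    module

/-- The operator `D` acts on products of factors `W - t y` as a `w`-difference operator. -/
lemma Osc.D_mul_qprod_W (h : Osc w y κ e W M D) (s : k) (j : ℕ) :
    D * qprod w W ((w * s * y) • (1 : A)) (j + 1) =
      qprod w W ((w * s * y) • (1 : A)) j *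
        (w ^ (j + 1) • ((W - (s * y) • (1 : A)) * D) + ((1 - w ^ (j + 1)) * e) • (1 : A)) := by
  have hf : ∀ r : k, D * (W - (w * r) • (1 : A)) =
      w • ((W - r • (1 : A)) * D) + ((1 - w) * e) • (1 : A) := by
    intro r
    rw [mul_sub, sub_mul, h.DW]
    simp only [mul_smul_comm, smul_mul_assoc, one_mul, mul_one]
    module
  induction j with
  | zero =>
    simp only [qprod, pow_zero, one_smul, mul_one, one_mul, zero_add, pow_one]
    rw [mul_assoc w, hf]
  | succ j ih =>
    have e1 : w ^ (j + 1) • (w * s * y) • (1 : A) = (w * (w ^ (j + 1) * s * y)) • (1 : A) := by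
      module
    have e2 : W - (w ^ (j + 1) * s * y) • (1 : A) = W - w ^ j • (w * s * y) • (1 : A) := by module
    rw [qprod, e1, ← mul_assoc, hf, add_mul, smul_mul_assoc, mul_assoc, ih, e2, ← mul_assoc,
      ← qprod, smul_mul_assoc, one_mul, mul_add, mul_add]
    simp only [mul_smul_comm, mul_one]
    module

/-- The exchange relation `α(w s) β(s) = β(w s) α(s)`, for `α(s) = 1 - s M` and
`β(s) = W - s y`. -/
lemma Osc.exchange (h : Osc w y κ e W M D) (s : k) :
    (1 - (w * s) • M) * (W - (s * y) • (1 : A)) =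
      (W - (w * s * y) • (1 : A)) * (1 - s • M) := by
  simp only [mul_sub, sub_mul, mul_smul_comm, smul_mul_assoc, h.WM, one_mul, mul_one]
  module

/-- The factor `α(w ^ n s)` moves through `β(w ^ (n - 1) s) ⋯ β(s)`, leaving it as `α(s)`. -/
lemma Osc.factor_mul_qprod (h : Osc w y κ e W M D) (s : k) (n : ℕ) :
    (1 - (w ^ n * s) • M) * qprod w W ((s * y) • (1 : A)) n =
      qprod w W ((w * s * y) • (1 : A)) n * (1 - s • M) := by
  induction n with
  | zero => simp [qprod]
  | succ n ih =>
    have e1 : w ^ n • (s * y) • (1 : A) = (w ^ n * s * y) • (1 : A) := by module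
    have e2 : w ^ n • (w * s * y) • (1 : A) = (w * (w ^ n * s) * y) • (1 : A) := by module
    have e3 : w ^ (n + 1) * s = w * (w ^ n * s) := by ring
    rw [qprod, qprod, e1, e2, e3, ← mul_assoc, h.exchange, mul_assoc, ih, ← mul_assoc]

/-- The commutator of a product of factors `W - t y` with `M` loses one factor. -/
lemma Osc.qprod_mul_M (h : Osc w y κ e W M D) (s : k) (j : ℕ) :
    qprod w W ((w * s * y) • (1 : A)) (j + 1) * M - M * qprod w W ((w * s * y) • (1 : A)) (j + 1) =
      (1 - w ^ (j + 1)) • ((y • (1 : A) - M * W) * qprod w W ((w * s * y) • (1 : A)) j) := by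
  have hf : ∀ r : k, (W - r • (1 : A)) * M =
      w • (M * W) - r • M + ((1 - w) * y) • (1 : A) := by
    intro r
    rw [sub_mul, h.WM]
    simp only [smul_mul_assoc, one_mul]
    module
  induction j with
  | zero =>
    simp only [qprod, pow_zero, one_smul, mul_one, zero_add, pow_one]
    rw [hf, mul_sub, mul_smul_comm, mul_one]
    module
  | succ j ih =>
    set q := qprod w W ((w * s * y) • (1 : A)) with hq
    have hs : ∀ n, q (n + 1) = (W - (w ^ n * (w * s * y)) • (1 : A)) * q n := by
      intro n
      rw [hq, qprod, smul_smul]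
    have e1 : q (j + 1) * M = M * q (j + 1) +
        (1 - w ^ (j + 1)) • ((y • (1 : A) - M * W) * q j) := by rw [← ih]; abel
    rw [hs (j + 1), mul_assoc, e1, mul_add, ← mul_assoc _ M, hf, mul_smul_comm,
      ← mul_assoc _ _ (q j), mul_sub _ (y • (1 : A)), ← mul_assoc _ M, hf]
    have e2 : (w • (M * W) - (w ^ (j + 1) * (w * s * y)) • M + ((1 - w) * y) • (1 : A)) * W =
      (w • (M * W) + ((1 - w) * y) • (1 : A)) * W - (w ^ (j + 1) * (w * s * y)) • (M * W) := by
      simp only [add_mul, sub_mul, smul_mul_assoc]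
      abel
    rw [e2, hs j]
    simp only [mul_sub, add_mul, sub_mul, mul_smul_comm, smul_mul_assoc, one_mul, mul_one,
      mul_assoc, smul_add, smul_sub]
    match_scalars <;> ring

/-- The Casimir relation `hcas` multiplied by the `j` factors `β(w ^ (j + 1) t) ⋯ β(w ^ 2 t)`, and
rearranged in terms of `β(w ^ j t) ⋯ β(w t)`, where `β(s) = W - s y`. -/
lemma Osc.casimir_mul_qprod (h : Osc w y κ e W M D) {t ρ : k}
    (hcas : (w * t) • ((M * W - y • (1 : A)) * D) + e • (1 - (w * t) • M) -
      (κ * t) • (W - (w * t * y) • (1 : A)) = ρ • (1 : A)) (j : ℕ) :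
    (w ^ (j + 1) * t) • ((M * W - y • (1 : A)) * (qprod w W ((w * t * y) • (1 : A)) j * D)) +
        e • ((1 - (w ^ (j + 1) * t) • M) * qprod w W ((w * t * y) • (1 : A)) j) -
        (κ * t) • qprod w W ((w * t * y) • (1 : A)) (j + 1) =
      ρ • qprod w W ((w * (w * t) * y) • (1 : A)) j := by
  have hρ : ∀ C : A, ρ • C = (w * t) • ((M * W - y • (1 : A)) * (D * C)) +
      e • ((1 - (w * t) • M) * C) - (κ * t) • ((W - (w * t * y) • (1 : A)) * C) := by
    intro C
    rw [← one_mul C, ← smul_mul_assoc, ← hcas]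
    simp only [sub_mul, add_mul, smul_mul_assoc, one_mul, mul_assoc]
  have hr : w • (w * t * y) • (1 : A) = (w * (w * t) * y) • (1 : A) := by module
  have hW : Commute W ((w * t * y) • (1 : A)) := (Commute.one_right W).smul_right _
  have hl := qprod_succ_left (w := w) hW j
  rw [hr] at hl
  rw [hρ, ← hl]
  cases j with
  | zero =>
    simp only [qprod, zero_add, pow_one, mul_one, one_mul]
  | succ j =>
    have hl' := qprod_succ_left (w := w) hW j
    have hB := qprod_succ_right (w := w) (U := W) (V := (w * t * y) • (1 : A)) j
    rw [hr] at hl' hB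
    rw [h.D_mul_qprod_W, hl']
    have hcomm : (W - (w * t * y) • (1 : A)) * qprod w W ((w * (w * t) * y) • (1 : A)) j =
        qprod w W ((w * (w * t) * y) • (1 : A)) j * (W - (w * t * y) • (1 : A)) := by
      rw [← hl', hB]
    have hq : qprod w W ((w * (w * t) * y) • (1 : A)) (j + 1) =
        (W - (w ^ (j + 2) * t * y) • (1 : A)) * qprod w W ((w * (w * t) * y) • (1 : A)) j := by
      rw [qprod, smul_smul, show w ^ (j + 2) * t * y = w ^ j * (w * (w * t) * y) by ring]
    have hWq : W * qprod w W ((w * (w * t) * y) • (1 : A)) j =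
        qprod w W ((w * (w * t) * y) • (1 : A)) j * W :=
      (commute_qprod (Commute.refl W) ((Commute.one_right W).smul_right _) j).eq
    rw [hq]
    generalize qprod w W ((w * (w * t) * y) • (1 : A)) j = C at *
    generalize qprod w W ((w * t * y) • (1 : A)) (j + 1 + 1) = C'
    have hWq' : ∀ Y, C * (W * Y) = W * (C * Y) := fun Y => by
      rw [← mul_assoc, ← hWq, mul_assoc]
    simp only [mul_add, mul_sub, sub_mul, mul_smul_comm, smul_mul_assoc, one_mul, mul_one,
      smul_add, smul_sub, mul_assoc, hWq']
    match_scalars <;> ring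

/-- The `w`-commutator of `D` with column `l` of the fusion of `N` factors, cyclic in the sense that
`w ^ N = 1`, is a multiple of column `l - 1` of the fusion of the `N - 2` factors that remain when
the first and the last one are dropped. Here `l = j + 1` and `N = j + p + 2`. -/
lemma Osc.D_mul_column (h : Osc w y κ e W M D) {t ρ : k}
    (hcas : (w * t) • ((M * W - y • (1 : A)) * D) + e • (1 - (w * t) • M) -
      (κ * t) • (W - (w * t * y) • (1 : A)) = ρ • (1 : A)) {j p : ℕ} (hw : w ^ (j + p + 2) = 1) :
    D * (qprod w 1 ((w ^ (j + 2) * t) • M) (p + 1) * qprod w W ((w * t * y) • (1 : A)) (j + 1)) -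
        w ^ (j + 1) • (qprod w 1 ((w ^ (j + 2) * t) • M) (p + 1) *
          qprod w W ((w * t * y) • (1 : A)) (j + 1) * D) =
      ((1 - w ^ (j + 1)) * ρ) • (qprod w 1 ((w ^ (j + 2) * t) • M) p *
        qprod w W ((w * (w * t) * y) • (1 : A)) j) := by
  have hs : w ^ (j + 2) * t = w * (w ^ (j + 1) * t) := by ring
  have hD : D * qprod w 1 ((w ^ (j + 2) * t) • M) (p + 1) =
      qprod w 1 ((w ^ (j + 2) * t) • M) p *
        ((1 - (w ^ (j + 1) * t) • M) * D - (κ * t * (1 - w ^ (j + 1))) • (1 : A)) := by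
    rw [hs, h.D_mul_qprod_M]
    have : κ * (w ^ (j + 1) * t) * (1 - w ^ (p + 1)) = - (κ * t * (1 - w ^ (j + 1))) := by
      linear_combination (-κ * t) * hw
    rw [this, neg_smul, ← sub_eq_add_neg]
  -- Cyclicity: the last of the factors `α` is `1 - w ^ (j + p + 2) t M = 1 - t M`.
  have hA : qprod w 1 ((w ^ (j + 2) * t) • M) (p + 1) =
      qprod w 1 ((w ^ (j + 2) * t) • M) p * (1 - t • M) := by
    have : w ^ p • (w ^ (j + 2) * t) • M = t • M := by
      rw [smul_smul, ← mul_assoc, ← pow_add, show p + (j + 2) = j + p + 2 by ring, hw, one_mul]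
    rw [qprod, this]
    refine (commute_qprod (Commute.one_right _) ?_ p).eq
    exact (((Commute.one_left M).sub_left ((Commute.refl M).smul_left t))).smul_right _
  have hex := h.factor_mul_qprod t (j + 1)
  rw [qprod_succ_right, show w • (t * y) • (1 : A) = (w * t * y) • (1 : A) by module] at hex
  have hcomm := h.qprod_mul_M t j
  have hDB := h.D_mul_qprod_W t j
  have hfin := h.casimir_mul_qprod hcas j
  rw [← mul_assoc, hD, hA, mul_smul (1 - w ^ (j + 1)) ρ, ← mul_smul_comm ρ, ← hfin]
  set P := qprod w 1 ((w ^ (j + 2) * t) • M) p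
  set B := qprod w W ((w * t * y) • (1 : A)) j
  set B1 := qprod w W ((w * t * y) • (1 : A)) (j + 1)
  -- Both sides have the left factor `P`; the terms with `B1 * D` cancel against each other, and
  -- what remains is divisible by `1 - w ^ (j + 1)`.
  have e1 : ((1 - (w ^ (j + 1) * t) • M) * D - (κ * t * (1 - w ^ (j + 1))) • (1 : A)) * B1 =
      w ^ (j + 1) • (B1 * ((1 - t • M) * D)) +
        (1 - w ^ (j + 1)) • (e • ((1 - (w ^ (j + 1) * t) • M) * B) - (κ * t) • B1) := by
    rw [sub_mul, mul_assoc, hDB, mul_add, mul_add, mul_smul_comm, mul_smul_comm, ← mul_assoc B,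
      ← mul_assoc _ (B * _) D, hex, mul_smul_comm, mul_smul_comm, mul_one, smul_mul_assoc, one_mul,
      mul_assoc B1]
    module
  have e2 : B1 * ((1 - t • M) * D) = (1 - t • M) * (B1 * D) +
      (t * (1 - w ^ (j + 1))) • ((M * W - y • (1 : A)) * (B * D)) := by
    have : B1 * (1 - t • M) = (1 - t • M) * B1 +
        (t * (1 - w ^ (j + 1))) • ((M * W - y • (1 : A)) * B) := by
      rw [mul_sub, mul_smul_comm, eq_add_of_sub_eq hcomm]
      simp only [sub_mul, mul_one, one_mul, smul_mul_assoc]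
      module
    rw [← mul_assoc, this, add_mul, smul_mul_assoc, mul_assoc, mul_assoc]
  rw [mul_assoc P, e1, e2, mul_assoc P, mul_assoc P, mul_assoc _ B1 D]
  simp only [mul_add, mul_sub, mul_smul_comm, smul_add, smul_sub]
  module

end Oscillator

/-! ### Columns of a cyclic fusion -/

section Columns

variable {k A : Type*} [CommRing k] [Ring A] [Algebra k A] {w y κ e : k} {W M D : A}

lemma Osc.D_mul_first_column (h : Osc w y κ e W M D) (t : k) {n : ℕ} (hw : w ^ (n + 1) = 1) :
    D * qprod w 1 ((w * t) • M) (n + 1) = qprod w 1 ((w * t) • M) (n + 1) * D := by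
  have e1 : w ^ n • (w * t) • M = t • M := by
    rw [smul_smul, ← mul_assoc, ← pow_succ, hw, one_mul]
  have hc : Commute (1 - t • M) (qprod w 1 ((w * t) • M) n) := by
    refine commute_qprod (Commute.one_right _) ?_ n
    exact ((Commute.one_left M).sub_left ((Commute.refl M).smul_left t)).smul_right _
  rw [h.D_mul_qprod_M, hw, sub_self, mul_zero, zero_smul, add_zero, qprod, e1, hc.eq, mul_assoc]

lemma Osc.D_mul_last_column (h : Osc w y κ e W M D) (t : k) {n : ℕ} (hw : w ^ (n + 1) = 1) :
    D * qprod w W ((w * t * y) • (1 : A)) (n + 1) =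
      qprod w W ((w * t * y) • (1 : A)) (n + 1) * D := by
  have e1 : w ^ n • (w * t * y) • (1 : A) = (t * y) • (1 : A) := by
    rw [smul_smul, mul_assoc w, ← mul_assoc (w ^ n), ← pow_succ, hw, one_mul]
  have hc : Commute (W - (t * y) • (1 : A)) (qprod w W ((w * t * y) • (1 : A)) n) := by
    refine commute_qprod ?_ ((Commute.one_right _).smul_right _) n
    exact (Commute.refl W).sub_left ((Commute.one_left W).smul_left _)
  rw [h.D_mul_qprod_W, hw, sub_self, zero_mul, zero_smul, add_zero, one_smul, qprod, e1, hc.eq,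
    ← mul_assoc]

variable {R : Type*} [Ring R] [Algebra k R[X]]

/-- The column polynomials of a fusion whose factors have columns `1 - t M` and `g (W - t y)`. -/
lemma symCol_eq_qprod {K : ℕ → Matrix (Fin 2) (Fin 2) R} {s g : k} {M W : R[X]}
    (hα : ∀ m, colPoly (K m) 0 = 1 - (w ^ m * s) • M)
    (hβ : ∀ m, colPoly (K m) 1 = g • (W - (w ^ m * (s * y)) • (1 : R[X]))) (n : ℕ) :
    ∀ l, l ≤ n → symCol K n l = g ^ l • (qprod w 1 ((w ^ l * s) • M) (n - l) *
      qprod w W ((s * y) • (1 : R[X])) l) := by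
  induction n with
  | zero =>
    intro l hl
    obtain rfl : l = 0 := by omega
    simp [symCol, qprod]
  | succ n ih =>
    intro l hl
    rcases hl.lt_or_eq with h | rfl
    · obtain ⟨d, rfl⟩ : ∃ d, n = l + d := ⟨n - l, by omega⟩
      have e1 : l + d + 1 - l = d + 1 := by omega
      have e2 : w ^ d • (w ^ l * s) • M = (w ^ (l + d) * s) • M := by module
      rw [symCol_succ_of_le (by omega), ih l (by omega), hα, e1, Nat.add_sub_cancel_left, qprod, e2,
        mul_smul_comm, mul_assoc]
    · rw [symCol_succ_self, ih n le_rfl, hβ, Nat.sub_self, Nat.sub_self, qprod, smul_mul_smul_comm,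
        ← pow_succ', qprod, one_mul, one_mul, qprod, smul_smul (w ^ n)]

end Columns

/-! ### Weyl pairs -/

section Weyl

variable {k A : Type*} [CommRing k] [Ring A] [Algebra k A]

/-- The relations between invertible operators `X`, `Z` with `Z X = w X Z`; `D` and `Zi` are the
inverses of `X` and `Z`, and `w'` is that of `w`. -/
structure Weyl (w w' : k) (X D Z Zi : A) : Prop where
  ww' : w * w' = 1
  ZX : Z * X = w • (X * Z)
  XD : X * D = 1
  DX : D * X = 1
  ZZi : Z * Zi = 1
  ZiZ : Zi * Z = 1

variable {w w' : k} {X D Z Zi : A}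

lemma Weyl.smul_smul (h : Weyl w w' X D Z Zi) (T : A) : w' • w • T = T := by
  rw [_root_.smul_smul, mul_comm, h.ww', one_smul]

lemma Weyl.ZiX (h : Weyl w w' X D Z Zi) : Zi * X = w' • (X * Zi) := by
  have : Zi * (Z * X) * Zi = Zi * (w • (X * Z)) * Zi := by rw [h.ZX]
  rw [← mul_assoc, h.ZiZ, one_mul, mul_smul_comm, smul_mul_assoc, mul_assoc, mul_assoc, h.ZZi,
    mul_one] at this
  rw [this, h.smul_smul]

lemma Weyl.ZD (h : Weyl w w' X D Z Zi) : Z * D = w' • (D * Z) := by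
  have : D * (Z * X) * D = D * (w • (X * Z)) * D := by rw [h.ZX]
  rw [mul_assoc, mul_assoc, h.XD, mul_one, mul_smul_comm, smul_mul_assoc, ← mul_assoc, h.DX,
    one_mul] at this
  rw [this, h.smul_smul]

lemma Weyl.ZiD (h : Weyl w w' X D Z Zi) : Zi * D = w • (D * Zi) := by
  have : D * (Zi * X) * D = D * (w' • (X * Zi)) * D := by rw [h.ZiX]
  rw [mul_assoc, mul_assoc, h.XD, mul_one, mul_smul_comm, smul_mul_assoc, ← mul_assoc, h.DX,
    one_mul] at this
  rw [this, _root_.smul_smul, h.ww', one_smul]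

/-- The operator `M` such that the first column of the `L`-operator is `1 - t M`. -/
def mOp (a' bi' κ x : k) (X Zi : A) : A := κ • X + (x * bi') • Zi - (x * a' * κ) • (X * Zi)

/-- The operator `W` such that the second column of the `L`-operator is proportional to
`W - t y`. -/
def wOp (w a a' b κ x : k) (X Z : A) : A :=
  Z - (w * a * b * κ) • (X * Z) + (w * a * a' * b * κ * x) • X

lemma Weyl.osc (h : Weyl w w' X D Z Zi) (a a' b bi' κ x : k) :
    Osc w (x * bi') κ (w * a * a' * b * κ * x) (wOp w a a' b κ x X Z) (mOp a' bi' κ x X Zi) D := by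
  have ww := h.ww'
  have a1 : ∀ T, Z * (X * T) = w • (X * (Z * T)) := fun T => by
    rw [← mul_assoc, h.ZX, smul_mul_assoc, mul_assoc]
  have a2 : ∀ T, Zi * (X * T) = w' • (X * (Zi * T)) := fun T => by
    rw [← mul_assoc, h.ZiX, smul_mul_assoc, mul_assoc]
  have a3 : ∀ T, D * (X * T) = T := fun T => by rw [← mul_assoc, h.DX, one_mul]
  have a4 : ∀ T, X * (D * T) = T := fun T => by rw [← mul_assoc, h.XD, one_mul]
  constructor
  all_goals
    simp only [wOp, mOp, mul_add, add_mul, mul_sub, sub_mul, smul_mul_assoc, mul_smul_comm,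
      mul_assoc, h.ZX, h.ZiX, h.ZD, h.ZiD, h.XD, h.DX, h.ZZi, h.ZiZ, a1, a2, a3, a4, mul_one]
    match_scalars <;> grind

/-- The cubic relation between the operators `M`, `W` and `D`; for the parameters of the
`L`-operator its right-hand side is `b x q(t)`. -/
lemma Weyl.casimir (h : Weyl w w' X D Z Zi) {a a' b b' bi' κ x t : k} (hb : b' * bi' = 1) :
    (w * t) • ((mOp a' bi' κ x X Zi * wOp w a a' b κ x X Z - (x * bi') • (1 : A)) * D) +
      (w * a * a' * b * κ * x) • (1 - (w * t) • mOp a' bi' κ x X Zi) -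
      (κ * t) • (wOp w a a' b κ x X Z - (w * t * (x * bi')) • (1 : A)) =
    (w * κ * (x * bi') * ((a * b - t) * (a' * b' - t))) • (1 : A) := by
  have ww := h.ww'
  have a2 : ∀ T, Zi * (X * T) = w' • (X * (Zi * T)) := fun T => by
    rw [← mul_assoc, h.ZiX, smul_mul_assoc, mul_assoc]
  have a4 : ∀ T, X * (D * T) = T := fun T => by rw [← mul_assoc, h.XD, one_mul]
  simp only [wOp, mOp, mul_add, add_mul, mul_sub, sub_mul, smul_mul_assoc, mul_smul_comm,
    mul_assoc, h.ZiX, h.ZD, h.ZiD, h.XD, h.ZiZ, a2, a4, mul_one, one_mul,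
    smul_sub, smul_add]
  match_scalars <;> grind

end Weyl

/-! ### Products over the roots of unity -/

section RootsOfUnity

lemma prod_range_sub_mul_pow {S : Type*} [CommRing S] [IsDomain S] {n : ℕ} (hn : 0 < n) {ζ : S}
    (h : IsPrimitiveRoot ζ n) (x y : S) :
    ∏ i ∈ Finset.range n, (x - ζ ^ i * y) = x ^ n - y ^ n := by
  rw [h.pow_sub_pow_eq_prod_sub_mul x y hn]
  have : NeZero n := ⟨hn.ne'⟩
  refine Finset.prod_nbij (fun i => ζ ^ i) ?_ h.injOn_pow ?_ fun _ _ => rfl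
  · intro i _
    rw [mem_nthRootsFinset hn, ← pow_mul, mul_comm, pow_mul, h.pow_eq_one, one_pow]
  · intro z hz
    obtain ⟨i, hi, rfl⟩ := h.eq_pow_of_pow_eq_one ((mem_nthRootsFinset hn 1).1 hz)
    exact ⟨i, by simpa using hi, rfl⟩

/-- The factorization of `u ^ n - v ^ n` for polynomials `u`, `v` in an element `T` of a ring which
need not be commutative. -/
lemma qprod_aeval {R : Type*} [Ring R] [Algebra ℂ R] {n : ℕ} (hn : 0 < n) {w : ℂ}
    (h : IsPrimitiveRoot w n) (T : R) (p q : ℂ[X]) :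
    qprod w (aeval T p) (aeval T q) n = aeval T p ^ n - aeval T q ^ n := by
  have hq : ∀ m, qprod w (aeval T p) (aeval T q) m =
      aeval T (∏ i ∈ Finset.range m, (p - C w ^ i * q)) := by
    intro m
    induction m with
    | zero => simp [qprod]
    | succ m ih =>
      rw [qprod, ih, Finset.prod_range_succ, mul_comm (∏ _ ∈ _, _), map_mul, map_sub, map_mul,
        map_pow, aeval_C, ← map_pow, ← Algebra.smul_def]
  rw [hq, prod_range_sub_mul_pow hn (h.map_of_injective C_injective), map_sub, map_pow, map_pow]

end RootsOfUnity

/-! ### Descending products -/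

section Descending

variable {R : Type*} [Ring R]

/-- The product `f (n - 1) ⋯ f 1 f 0`. -/
def prodDown (f : ℕ → R) : ℕ → R
  | 0 => 1
  | n + 1 => f n * prodDown f n

lemma prodDown_sub [Algebra ℂ R] (w : ℂ) (U V : R) (n : ℕ) :
    prodDown (fun m => U - w ^ m • V) n = qprod w U V n := by
  induction n with
  | zero => rfl
  | succ n ih => rw [prodDown, ih, qprod]

lemma prodDown_const (T : R) (n : ℕ) : prodDown (fun _ => T) n = T ^ n := by
  induction n with
  | zero => simp [prodDown]
  | succ n ih => rw [prodDown, ih, pow_succ']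

lemma coeff_symCol_first (K : ℕ → Matrix (Fin 2) (Fin 2) R) (n : ℕ) :
    (symCol K n 0).coeff 0 = prodDown (fun m => K m 0 0) n ∧
      (symCol K n 0).coeff n = prodDown (fun m => K m 1 0) n := by
  induction n with
  | zero => simp [symCol, prodDown]
  | succ n ih =>
    rw [symCol_succ_of_le (by omega), coeff_colPoly_mul_zero, coeff_colPoly_mul_succ, ih.1, ih.2,
      coeff_symCol_of_lt _ _ _ (Nat.lt_succ_self n), mul_zero, zero_add]
    exact ⟨rfl, rfl⟩

lemma coeff_symCol_last (K : ℕ → Matrix (Fin 2) (Fin 2) R) (n : ℕ) :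
    (symCol K n n).coeff 0 = prodDown (fun m => K m 0 1) n ∧
      (symCol K n n).coeff n = prodDown (fun m => K m 1 1) n := by
  induction n with
  | zero => simp [symCol, prodDown]
  | succ n ih =>
    rw [symCol_succ_self, coeff_colPoly_mul_zero, coeff_colPoly_mul_succ, ih.1, ih.2,
      coeff_symCol_of_lt _ _ _ (Nat.lt_succ_self n), mul_zero, zero_add]
    exact ⟨rfl, rfl⟩

/-- For a commuting cyclic family, the descending product from `f n = f 0` to `f 1` is the
ascending product from `f 0` to `f (n - 1)`. -/
lemma prod_ofFn_eq_prodDown {f : ℕ → R} (hf : ∀ i j, Commute (f i) (f j)) {n : ℕ}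
    (hn : f n = f 0) : (List.ofFn fun i : Fin n => f i).prod = prodDown (fun m => f (m + 1)) n := by
  cases n with
  | zero => simp [prodDown]
  | succ n =>
    have hc : ∀ i m, Commute (f i) (prodDown (fun m => f (m + 1)) m) := by
      intro i m
      induction m with
      | zero => exact Commute.one_right _
      | succ m ih => exact (hf i (m + 1)).mul_right ih
    have h : ∀ m, (List.ofFn fun i : Fin (m + 1) => f i).prod =
        prodDown (fun m => f (m + 1)) m * f 0 := by
      intro m
      induction m with
      | zero => simp [prodDown]
      | succ m ih =>
        rw [List.ofFn_succ', List.concat_eq_append, List.prod_append]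
        simp only [Fin.val_castSucc, Fin.val_last, List.prod_singleton]
        rw [ih, prodDown, mul_assoc, (hf 0 (m + 1)).eq, ← mul_assoc, ← (hc (m + 1) m).eq]
    rw [h, prodDown, hn, (hc 0 n).eq]

end Descending

/-! ### The Weyl operators of one site -/

section Concrete

lemma om_ne_zero (N : ℕ) : om N ≠ 0 := Complex.exp_ne_zero _

variable (N : ℕ) [NeZero N]

lemma om_primitive : IsPrimitiveRoot (om N) N := Complex.isPrimitiveRoot_exp N (NeZero.ne N)

lemma om_pow : om N ^ N = 1 := (om_primitive N).pow_eq_one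

lemma weylX_pow_apply (m : ℕ) (i j : ZMod N) :
    (weylX N ^ m) i j = if i = j + (m : ZMod N) then 1 else 0 := by
  induction m generalizing j with
  | zero => simp [Matrix.one_apply]
  | succ m ih =>
    rw [pow_succ, Matrix.mul_apply, Finset.sum_eq_single (j + 1)]
    · simp only [ih, weylX, if_true, mul_one, Nat.cast_add, Nat.cast_one, add_assoc,
        add_comm (1 : ZMod N)]
    · intro l _ hl
      simp [weylX, hl]
    · simp

lemma weylX_pow_self : weylX N ^ N = 1 := by
  ext i j
  simp [weylX_pow_apply, Matrix.one_apply]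

lemma weylZ_pow_self : weylZ N ^ N = 1 := by
  rw [weylZ, Matrix.diagonal_pow, ← Matrix.diagonal_one]
  congr 1
  ext n
  rw [Pi.pow_apply, ← pow_mul, mul_comm, pow_mul, om_pow, one_pow]

lemma om_pow_val_add_one (n : ZMod N) : om N ^ (n + 1).val = om N * om N ^ n.val := by
  rw [ZMod.val_add, ZMod.val_one_eq_one_mod, Nat.add_mod_mod, ← pow_eq_pow_mod _ (om_pow N),
    pow_succ']

lemma weylZ_mul_weylX : weylZ N * weylX N = om N • (weylX N * weylZ N) := by
  ext m n
  rw [weylZ, Matrix.diagonal_mul, Matrix.smul_apply, Matrix.mul_diagonal, weylX]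
  split_ifs with h
  · rw [h, om_pow_val_add_one]
    simp
  · simp

lemma weyl : Weyl (om N) (om N)⁻¹ (weylX N) (weylX N ^ (N - 1)) (weylZ N) (weylZ N)⁻¹ := by
  have hN : N - 1 + 1 = N := Nat.sub_add_cancel (NeZero.one_le)
  have hZ : weylZ N * weylZ N ^ (N - 1) = 1 := by rw [← pow_succ', hN, weylZ_pow_self]
  have hZ' : (weylZ N)⁻¹ = weylZ N ^ (N - 1) := Matrix.inv_eq_right_inv hZ
  constructor
  · exact mul_inv_cancel₀ (om_ne_zero N)
  · exact weylZ_mul_weylX N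
  · rw [← pow_succ', hN, weylX_pow_self]
  · rw [← pow_succ, hN, weylX_pow_self]
  · rw [hZ', hZ]
  · rw [hZ', ← pow_succ, hN, weylZ_pow_self]

end Concrete

/-! ### Exchange and Yang–Baxter relations of the `L`-operator -/

section LOperator

variable {N : ℕ} [NeZero N] {P : Params}

lemma lop_zero_zero (t : ℂ) :
    lop N P t 0 0 = 1 - (t * (P.c / (P.b' * P.b))) • weylX N := by
  simp [lop, mul_div_assoc]

lemma lop_zero_one (t : ℂ) :
    lop N P t 0 1 = P.b⁻¹ • weylZ N - (om N * P.a * (P.c / (P.b' * P.b))) •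
      (weylX N * weylZ N) := by
  simp [lop, mul_div_assoc, sub_mul]

lemma lop_one_zero (t : ℂ) :
    lop N P t 1 0 = (t * P.a' * (P.c / (P.b' * P.b))) • (weylX N * (weylZ N)⁻¹) -
      (t * P.b'⁻¹) • (weylZ N)⁻¹ := by
  simp [lop, mul_div_assoc, sub_mul, smul_sub, smul_smul, mul_assoc]
  abel

lemma lop_one_one (t : ℂ) :
    lop N P t 1 1 = (om N * P.a' * P.a * (P.c / (P.b' * P.b))) • weylX N -
      (t / (P.b' * P.b)) • (1 : SiteOp N) := by
  simp [lop, mul_div_assoc]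

/-- The exchange relations of the `L`-operator, with the quantum determinant `q(t) X`. -/
lemma exch_lop (hb : P.b ≠ 0) (hb' : P.b' ≠ 0) (t : ℂ) :
    Exch (lop N P (om N * t)) (lop N P t) (qdet N P t • weylX N) := by
  have h := weyl N
  have hω := om_ne_zero N
  have a1 : ∀ T, weylZ N * (weylX N * T) = om N • (weylX N * (weylZ N * T)) := fun T => by
    rw [← mul_assoc, h.ZX, smul_mul_assoc, mul_assoc]
  have a2 : ∀ T, (weylZ N)⁻¹ * (weylX N * T) = (om N)⁻¹ • (weylX N * ((weylZ N)⁻¹ * T)) :=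
    fun T => by rw [← mul_assoc, h.ZiX, smul_mul_assoc, mul_assoc]
  constructor
  all_goals
    simp only [lop_zero_zero, lop_zero_one, lop_one_zero, lop_one_one, mul_sub,
      sub_mul, smul_mul_assoc, mul_smul_comm, mul_assoc, h.ZX, h.ZiX, h.ZZi, h.ZiZ, a1, a2, mul_one,
      one_mul, qdet]
    match_scalars <;> field_simp <;> ring

/-- The six-vertex `R`-matrix, in the gauge adapted to the `L`-operator. -/
def rmat (w s s' : ℂ) : Matrix (Fin 2 × Fin 2) (Fin 2 × Fin 2) ℂ := fun p q =>
  if p = q then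
    if p.1 = p.2 then w * s - s' else if p.1 = 0 then (w - 1) * s else (w - 1) * s'
  else if p.1 ≠ p.2 ∧ q.1 ≠ q.2 then if q.1 = 0 then s - s' else w * (s - s') else 0

/-- The Yang–Baxter relation for the `L`-operator. -/
lemma intertwine_lop (s s' : ℂ) :
    (rmat (om N) s s').map (algebraMap ℂ (SiteOp N)) * tens (lop N P s) (lop N P s') =
      tens (lop N P s') (lop N P s) * (rmat (om N) s s').map (algebraMap ℂ (SiteOp N)) := by
  have h := weyl N
  have hω := om_ne_zero N
  have a1 : ∀ T, weylZ N * (weylX N * T) = om N • (weylX N * (weylZ N * T)) := fun T => by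
    rw [← mul_assoc, h.ZX, smul_mul_assoc, mul_assoc]
  have a2 : ∀ T, (weylZ N)⁻¹ * (weylX N * T) = (om N)⁻¹ • (weylX N * ((weylZ N)⁻¹ * T)) :=
    fun T => by rw [← mul_assoc, h.ZiX, smul_mul_assoc, mul_assoc]
  ext1 p q
  simp only [Matrix.mul_apply, Fintype.sum_prod_type, Fin.sum_univ_two, Matrix.map_apply,
    Algebra.algebraMap_eq_smul_one, tens, smul_mul_assoc, mul_smul_comm, one_mul, mul_one]
  obtain ⟨i, i'⟩ := p
  obtain ⟨j, j'⟩ := q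
  fin_cases i <;> fin_cases i' <;> fin_cases j <;> fin_cases j'
  all_goals
    simp [rmat]
    simp only [lop_zero_zero, lop_zero_one, lop_one_zero, lop_one_one, mul_sub,
      sub_mul, smul_mul_assoc, mul_smul_comm, mul_assoc, h.ZX, h.ZiX, h.ZZi, h.ZiZ, a1, a2, mul_one,
      one_mul]
  all_goals match_scalars <;> field_simp <;> ring

end LOperator

lemma mul_smul_sub_smul {k A : Type*} [CommRing k] [Ring A] [Algebra k A] (g w : k) (D G : A) :
    D * (g • G) - w • (g • G * D) = g • (D * G - w • (G * D)) := by
  rw [mul_smul_comm, smul_mul_assoc, smul_sub, smul_comm w]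

/-! ### Polynomials with a central indeterminate -/

section PolyAlgebra

variable {R : Type*} [Ring R] [Algebra ℂ R]

/-- The polynomials over a `ℂ`-algebra `R`, with a central indeterminate, as an algebra
over `ℂ[X]`. -/
abbrev polyAlgebra (R : Type*) [Ring R] [Algebra ℂ R] : Algebra ℂ[X] R[X] :=
  (mapRingHom (algebraMap ℂ R)).toAlgebra' fun c x => by
    induction c using Polynomial.induction_on' with
    | add p q hp hq => rw [map_add, add_mul, mul_add, hp, hq]
    | monomial n a =>
      rw [coe_mapRingHom, map_monomial, ← C_mul_X_pow_eq_monomial, mul_assoc, X_pow_mul,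
        ← mul_assoc, ← mul_assoc, ← Polynomial.algebraMap_apply, Algebra.commutes]

attribute [local instance] polyAlgebra

lemma C_smul_poly (c : ℂ) (p : R[X]) : (C c : ℂ[X]) • p = c • p := by
  rw [Algebra.smul_def, Algebra.smul_def, Polynomial.algebraMap_apply]
  congr 1
  exact map_C (algebraMap ℂ R)

lemma X_smul_poly (p : R[X]) : (X : ℂ[X]) • p = p * X := by
  rw [Algebra.smul_def, ← X_mul]
  congr 1
  exact map_X (algebraMap ℂ R)

lemma Weyl.poly {w w' : ℂ} {U D Z Zi : R} (h : Weyl w w' U D Z Zi) :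
    Weyl (C w : ℂ[X]) (C w') (C U : R[X]) (C D) (C Z) (C Zi) where
  ww' := by rw [← C_mul, h.ww', C_1]
  ZX := by rw [C_smul_poly, ← C_mul, ← C_mul, h.ZX, smul_C]
  XD := by rw [← C_mul, h.XD, C_1]
  DX := by rw [← C_mul, h.DX, C_1]
  ZZi := by rw [← C_mul, h.ZZi, C_1]
  ZiZ := by rw [← C_mul, h.ZiZ, C_1]

end PolyAlgebra

/-! ### Columns of the fused `L`-operator -/

section Boundary

variable {N : ℕ} [NeZero N] {P : Params}

attribute [local instance] polyAlgebra

/-- The operator `M` of the `L`-operator, over the polynomials in the auxiliary variable `x`. -/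
def lopM (N : ℕ) [NeZero N] (P : Params) : (SiteOp N)[X] :=
  mOp (C P.a' : ℂ[X]) (C P.b'⁻¹) (C (P.c / (P.b' * P.b))) X (C (weylX N)) (C (weylZ N)⁻¹)

/-- The operator `W` of the `L`-operator, over the polynomials in the auxiliary variable `x`. -/
def lopW (N : ℕ) [NeZero N] (P : Params) : (SiteOp N)[X] :=
  wOp (C (om N) : ℂ[X]) (C P.a) (C P.a') (C P.b) (C (P.c / (P.b' * P.b))) X
    (C (weylX N)) (C (weylZ N))

lemma colPoly_lop_zero (s : ℂ) (m : ℕ) :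
    colPoly (lop N P (om N ^ m * s)) 0 = 1 - ((C (om N)) ^ m * C s : ℂ[X]) • lopM N P := by
  rw [colPoly, lop_zero_zero, lop_one_zero, lopM, mOp, ← C_pow, ← C_mul, C_smul_poly]
  simp only [mul_smul, C_smul_poly, X_smul_poly, C_sub, C_mul, C_1, ← smul_C, sub_mul,
    smul_mul_assoc]
  module

lemma colPoly_lop_one (hb : P.b ≠ 0) (s : ℂ) (m : ℕ) :
    colPoly (lop N P (om N ^ m * s)) 1 = (C P.b⁻¹ : ℂ[X]) •
      (lopW N P - ((C (om N)) ^ m * (C s * (X * C P.b'⁻¹)) : ℂ[X]) • (1 : (SiteOp N)[X])) := by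
  rw [colPoly, lop_zero_one, lop_one_one, lopW, wOp, ← C_pow]
  simp only [mul_smul, C_smul_poly, X_smul_poly, C_sub, C_mul, C_1, ← smul_C, sub_mul, one_mul,
    smul_mul_assoc, smul_sub, smul_add]
  match_scalars <;> field_simp

lemma symCol_lop (hb : P.b ≠ 0) (s : ℂ) {n l : ℕ} (hl : l ≤ n) :
    symCol (fun m => lop N P (om N ^ m * s)) n l = (C P.b⁻¹ : ℂ[X]) ^ l •
      (qprod (C (om N) : ℂ[X]) 1 (((C (om N)) ^ l * C s : ℂ[X]) • lopM N P) (n - l) *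
        qprod (C (om N) : ℂ[X]) (lopW N P)
          ((C s * (X * C P.b'⁻¹) : ℂ[X]) • (1 : (SiteOp N)[X])) l) :=
  symCol_eq_qprod (colPoly_lop_zero s) (colPoly_lop_one hb s) n l hl

lemma lop_osc (N : ℕ) [NeZero N] (P : Params) :
    Osc (C (om N) : ℂ[X]) (X * C P.b'⁻¹) (C (P.c / (P.b' * P.b)))
      (C (om N) * C P.a * C P.a' * C P.b * C (P.c / (P.b' * P.b)) * X)
      (lopW N P) (lopM N P) (C (weylX N ^ (N - 1))) :=
  (weyl N).poly.osc _ _ _ _ _ _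

lemma C_om_pow (N : ℕ) [NeZero N] : (C (om N) : ℂ[X]) ^ N = 1 := by
  rw [← C_pow, om_pow, C_1]

/-- The `ω`-commutator of `X⁻¹` with an intermediate column of the fusion of `N` consecutive
`L`-operators is, up to a scalar, the preceding column of the fusion of the inner `N - 2` of them,
times `x`. -/
lemma D_mul_symCol_mid (hb : P.b ≠ 0) (hb' : P.b' ≠ 0) (t : ℂ) {j p : ℕ} (hN : j + p + 2 = N) :
    C (weylX N ^ (N - 1)) * symCol (fun m => lop N P (om N ^ m * (om N * t))) N (j + 1) -
      om N ^ (j + 1) • (symCol (fun m => lop N P (om N ^ m * (om N * t))) N (j + 1) *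
        C (weylX N ^ (N - 1))) =
    ((1 - om N ^ (j + 1)) * qdet N P t) •
      (symCol (fun m => lop N P (om N ^ m * (om N * (om N * t)))) (j + p) j * X) := by
  have hcas := (weyl N).poly.casimir (a := C P.a) (a' := C P.a') (b := C P.b) (b' := C P.b')
    (bi' := C P.b'⁻¹) (κ := C (P.c / (P.b' * P.b))) (x := X) (t := C t)
    (by rw [← C_mul, mul_inv_cancel₀ hb', C_1])
  have h := (lop_osc N P).D_mul_column hcas (j := j) (p := p) (by rw [hN, C_om_pow])
  have e1 : (C (om N) : ℂ[X]) ^ (j + 1) * C (om N * t) = C (om N) ^ (j + 2) * C t := by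
    rw [C_mul]; ring
  have e2 : (C (om N) : ℂ[X]) ^ j * C (om N * (om N * t)) = C (om N) ^ (j + 2) * C t := by
    rw [C_mul, C_mul]; ring
  have e3 : (C (qdet N P t) : ℂ[X]) = C P.b⁻¹ * C (om N) * C (P.c / (P.b' * P.b)) * C P.b'⁻¹ *
      ((C P.a * C P.b - C t) * (C P.a' * C P.b' - C t)) := by
    simp only [← C_mul, ← C_sub]
    congr 1
    rw [qdet]
    field_simp
  rw [symCol_lop hb _ (show j + 1 ≤ N by omega), symCol_lop hb _ (show j ≤ j + p by omega),
    show N - (j + 1) = p + 1 by omega, Nat.add_sub_cancel_left, e1, e2, C_mul, C_mul, C_mul,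
    ← C_smul_poly, show (C (om N ^ (j + 1)) : ℂ[X]) = C (om N) ^ (j + 1) from C_pow,
    mul_smul_sub_smul, h, smul_smul, ← C_smul_poly, ← X_smul_poly, smul_smul, smul_smul]
  congr 1
  rw [C_mul, e3, C_sub, C_1, C_pow]
  ring

/-- The first column of the fusion of `N` consecutive `L`-operators commutes with `X⁻¹`. -/
lemma D_mul_symCol_first (hb : P.b ≠ 0) (t : ℂ) :
    C (weylX N ^ (N - 1)) * symCol (fun m => lop N P (om N ^ m * (om N * t))) N 0 =
      symCol (fun m => lop N P (om N ^ m * (om N * t))) N 0 * C (weylX N ^ (N - 1)) := by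
  have hN : N - 1 + 1 = N := Nat.sub_add_cancel (NeZero.one_le)
  have h := (lop_osc N P).D_mul_first_column (C t) (n := N - 1) (by rw [hN, C_om_pow])
  rw [hN] at h
  rw [symCol_lop hb _ (Nat.zero_le N)]
  simpa [qprod] using h

/-- The last column of the fusion of `N` consecutive `L`-operators commutes with `X⁻¹`. -/
lemma D_mul_symCol_last (hb : P.b ≠ 0) (t : ℂ) :
    C (weylX N ^ (N - 1)) * symCol (fun m => lop N P (om N ^ m * (om N * t))) N N =
      symCol (fun m => lop N P (om N ^ m * (om N * t))) N N * C (weylX N ^ (N - 1)) := by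
  have hN : N - 1 + 1 = N := Nat.sub_add_cancel (NeZero.one_le)
  have h := (lop_osc N P).D_mul_last_column (C t) (n := N - 1) (by rw [hN, C_om_pow])
  rw [hN] at h
  rw [symCol_lop hb _ le_rfl, mul_smul_comm, smul_mul_assoc, Nat.sub_self, qprod, one_mul, C_mul, h]

/-- The grading of the fused `L`-operator: its entry in row `k` and column `l` is a polynomial in
`X` times `Z ^ (l - k)`. -/
lemma D_mul_coeff_symCol (f : ℕ → ℂ) (n : ℕ) : ∀ l k, l ≤ n →
    om N ^ k • (weylX N ^ (N - 1) * (symCol (fun m => lop N P (f m)) n l).coeff k) =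
      om N ^ l • ((symCol (fun m => lop N P (f m)) n l).coeff k * weylX N ^ (N - 1)) := by
  have h := weyl N
  have hω := om_ne_zero N
  have hXD : weylX N * weylX N ^ (N - 1) = weylX N ^ (N - 1) * weylX N := h.XD.trans h.DX.symm
  set D := weylX N ^ (N - 1)
  have hXD' : ∀ T, D * (weylX N * T) = weylX N * (D * T) := fun T => by
    rw [← mul_assoc, ← hXD, mul_assoc]
  have h00 : ∀ t, om N ^ 0 • (D * lop N P t 0 0) = om N ^ 0 • (lop N P t 0 0 * D) := by
    intro t
    rw [lop_zero_zero, mul_sub, sub_mul, mul_smul_comm, smul_mul_assoc, hXD, mul_one, one_mul]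
  have h10 : ∀ t, om N ^ 1 • (D * lop N P t 1 0) = om N ^ 0 • (lop N P t 1 0 * D) := by
    intro t
    rw [lop_one_zero]
    simp only [mul_sub, sub_mul, mul_smul_comm, smul_mul_assoc, mul_assoc, h.ZiD, hXD']
    module
  have h01 : ∀ t, om N ^ 0 • (D * lop N P t 0 1) = om N ^ 1 • (lop N P t 0 1 * D) := by
    intro t
    rw [lop_zero_one]
    simp only [mul_sub, sub_mul, mul_smul_comm, smul_mul_assoc, mul_assoc, h.ZD, hXD']
    match_scalars <;> field_simp
  have h11 : ∀ t, om N ^ 1 • (D * lop N P t 1 1) = om N ^ 1 • (lop N P t 1 1 * D) := by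
    intro t
    rw [lop_one_one, mul_sub, sub_mul, mul_smul_comm, smul_mul_assoc, hXD, mul_smul_comm,
      smul_mul_assoc, mul_one, one_mul]
  have step : ∀ {i r k l : ℕ} {E p : SiteOp N}, om N ^ i • (D * E) = om N ^ r • (E * D) →
      om N ^ k • (D * p) = om N ^ l • (p * D) →
      om N ^ (k + i) • (D * (E * p)) = om N ^ (l + r) • (E * p * D) := by
    intro i r k l E p hE hp
    rw [pow_add, mul_smul, ← mul_assoc, ← smul_mul_assoc, hE, smul_mul_assoc, smul_comm, mul_assoc,
      ← mul_smul_comm, hp, mul_smul_comm, smul_smul, ← pow_add, mul_assoc, add_comm r]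
  induction n with
  | zero =>
    intro l k hl
    obtain rfl : l = 0 := by omega
    cases k with
    | zero => simp [symCol]
    | succ k => simp [symCol, coeff_one]
  | succ n ih =>
    intro l k hl
    rcases hl.lt_or_eq with hlt | rfl
    · rw [symCol_succ_of_le (by omega)]
      have ih' := fun k => ih l k (by omega)
      cases k with
      | zero =>
        rw [coeff_colPoly_mul_zero]
        exact step (h00 _) (ih' 0)
      | succ k =>
        rw [coeff_colPoly_mul_succ, mul_add, add_mul, smul_add, smul_add]
        exact congrArg₂ (· + ·) (step (i := 0) (h00 _) (ih' (k + 1))) (step (h10 _) (ih' k))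
    · rw [symCol_succ_self]
      have ih' := fun k => ih n k le_rfl
      cases k with
      | zero =>
        rw [coeff_colPoly_mul_zero]
        exact step (h01 _) (ih' 0)
      | succ k =>
        rw [coeff_colPoly_mul_succ, mul_add, add_mul, smul_add, smul_add]
        exact congrArg₂ (· + ·) (step (i := 0) (h01 _) (ih' (k + 1))) (step (h11 _) (ih' k))

end Boundary

/-! ### Averages of the `L`-operator -/

section Averages

variable {R : Type*} [Ring R] [Algebra ℂ R] {n : ℕ} {w : ℂ}

lemma qprod_smul_one_smul (hn : 0 < n) (h : IsPrimitiveRoot w n) (T : R) (u v : ℂ) :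
    qprod w (u • (1 : R)) (v • T) n = (u • (1 : R)) ^ n - (v • T) ^ n := by
  have := qprod_aeval hn h T (C u) (C v * X)
  simpa [Algebra.algebraMap_eq_smul_one] using this

lemma qprod_smul_smul_one (hn : 0 < n) (h : IsPrimitiveRoot w n) (T : R) (u v : ℂ) :
    qprod w (u • T) (v • (1 : R)) n = (u • T) ^ n - (v • (1 : R)) ^ n := by
  have := qprod_aeval hn h T (C u * X) (C v)
  simpa [Algebra.algebraMap_eq_smul_one] using this

lemma sub_mul_pow_eq (hn : 0 < n) (h : IsPrimitiveRoot w n) {T Z : R} (hZT : Z * T = w • (T * Z))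
    (hT : T ^ n = 1) (hZ : Z ^ n = 1) (u v : ℂ) :
    ((u • (1 : R) - v • T) * Z) ^ n = (u ^ n - v ^ n) • (1 : R) := by
  rw [sub_mul_pow_eq_qprod (w := w), qprod_smul_one_smul hn h, hZ, _root_.smul_pow,
    _root_.smul_pow, hT, one_pow, mul_one, sub_smul]
  · exact ((Commute.one_left T).smul_right v).smul_left u
  · rw [mul_smul_comm, smul_mul_assoc, one_mul, mul_one]
  · rw [mul_smul_comm, hZT, smul_mul_assoc, smul_comm]

variable {N : ℕ} [NeZero N] {P : Params}

/-- The averages of the four entries of the `L`-operator are scalars, namely the entries of the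
classical `L`-operator. -/
lemma prodDown_lop (hb : P.b ≠ 0) (hb' : P.b' ≠ 0) (t : ℂ) (i j : Fin 2) :
    prodDown (fun m => lop N P (om N ^ m * (om N * t)) i j) N =
      algebraMap ℂ (SiteOp N) (classicalL N P t i j) := by
  have hn : 0 < N := NeZero.pos N
  have hω := om_primitive N
  have hW := weyl N
  have hX := weylX_pow_self N
  have hZi : (weylZ N)⁻¹ ^ N = 1 := by
    rw [Matrix.inv_pow', weylZ_pow_self, inv_one]
  have hωt : ∀ x : ℂ, (om N * x) ^ N = x ^ N := fun x => by rw [mul_pow, om_pow, one_mul]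
  rw [Algebra.algebraMap_eq_smul_one]
  fin_cases i <;> fin_cases j
  · have e : ∀ m, lop N P (om N ^ m * (om N * t)) 0 0 =
        (1 : ℂ) • (1 : SiteOp N) - om N ^ m • ((om N * (t * (P.c / (P.b' * P.b)))) • weylX N) := by
      intro m
      rw [lop_zero_zero]
      module
    simp only [Fin.zero_eta, e]
    rw [prodDown_sub, qprod_smul_one_smul hn hω, _root_.smul_pow, _root_.smul_pow, hX, hωt]
    simp only [classicalL, Matrix.smul_apply, Matrix.of_apply, Matrix.cons_val, smul_eq_mul,
      one_pow, mul_pow, div_pow]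
    match_scalars
    field_simp
  · have e : ∀ m, lop N P (om N ^ m * (om N * t)) 0 1 =
        ((P.b⁻¹ • (1 : SiteOp N)) - (om N * (P.a * (P.c / (P.b' * P.b)))) • weylX N) * weylZ N := by
      intro m
      rw [lop_zero_one, sub_mul, smul_mul_assoc, smul_mul_assoc, one_mul, mul_assoc]
    simp only [Fin.zero_eta, Fin.mk_one, e]
    rw [prodDown_const, sub_mul_pow_eq hn hω hW.ZX hX (weylZ_pow_self N), hωt]
    simp only [classicalL, Matrix.smul_apply, Matrix.of_apply, Matrix.cons_val, smul_eq_mul]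
    congr 1
    simp only [inv_pow, mul_pow, div_pow]
    field_simp
  · have e : ∀ m, lop N P (om N ^ m * (om N * t)) 1 0 =
        (0 : ℂ) • (1 : SiteOp N) - om N ^ m • ((om N * t) •
          ((P.b'⁻¹ • (1 : SiteOp N) - (P.a' * (P.c / (P.b' * P.b))) • weylX N) *
            (weylZ N)⁻¹)) := by
      intro m
      rw [lop_one_zero, sub_mul, smul_mul_assoc, smul_mul_assoc, one_mul]
      module
    simp only [Fin.zero_eta, Fin.mk_one, e]
    rw [prodDown_sub, qprod_smul_one_smul hn hω, _root_.smul_pow, _root_.smul_pow _ _ N,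
      sub_mul_pow_eq hn hω.inv hW.ZiX hX hZi, hωt]
    simp only [classicalL, Matrix.smul_apply, Matrix.of_apply, Matrix.cons_val, smul_eq_mul,
      one_pow, mul_pow, div_pow, inv_pow]
    match_scalars
    rw [zero_pow hn.ne']
    field_simp
    ring
  · have e : ∀ m, lop N P (om N ^ m * (om N * t)) 1 1 =
        (om N * (P.a' * P.a * (P.c / (P.b' * P.b)))) • weylX N -
          om N ^ m • ((om N * (t / (P.b' * P.b))) • (1 : SiteOp N)) := by
      intro m
      rw [lop_one_one]
      module
    simp only [Fin.mk_one, e]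
    rw [prodDown_sub, qprod_smul_smul_one hn hω, _root_.smul_pow, _root_.smul_pow, hX, hωt, hωt]
    simp only [classicalL, Matrix.smul_apply, Matrix.of_apply, Matrix.cons_val, smul_eq_mul,
      one_pow, mul_pow, div_pow]
    match_scalars
    field_simp

end Averages

/-! ### Block structure of the fusion of `N` factors -/

section Block

lemma val_mid {M : ℕ} (k : Fin M) : ((mid k : Fin (M + 2)) : ℕ) = k + 1 := by simp [mid]

lemma val_ends_zero (M : ℕ) : ((ends M 0 : Fin (M + 2)) : ℕ) = 0 := by simp [ends]

lemma val_ends_one (M : ℕ) : ((ends M 1 : Fin (M + 2)) : ℕ) = M + 1 := by simp [ends]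

lemma exch_lop_seq {N : ℕ} [NeZero N] {P : Params} (hb : P.b ≠ 0) (hb' : P.b' ≠ 0) (s : ℂ) (m : ℕ) :
    Exch (lop N P (om N ^ (m + 1) * s)) (lop N P (om N ^ m * s))
      (qdet N P (om N ^ m * s) • weylX N) := by
  rw [pow_succ', mul_assoc]
  exact exch_lop hb hb' _

lemma one_sub_om_pow_ne_zero {M : ℕ} (k : Fin M) : 1 - om (M + 1) ^ ((k : ℕ) + 1) ≠ 0 := by
  rw [sub_ne_zero]
  exact ((om_primitive (M + 1)).pow_ne_one_of_pos_of_lt (by omega) (by omega)).symm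

/-- The block structure of the fusion of the `N` operators `L(ω t), …, L(ω ^ N t)`, where
`N = M + 1`: its intermediate entries satisfy
`(1 - ω ^ k) F_{k,l} = (1 - ω ^ l) q(t) X F'_{k-1,l-1}`, with `F'` the fusion of `L(ω ^ 2 t), …, L(ω ^ (N - 1) t)`. -/
lemma blockTri_lop {M : ℕ} {P : Params} (hb : P.b ≠ 0) (hb' : P.b' ≠ 0) (t : ℂ) :
    BlockTri (symMat (fun m => lop (M + 1) P (om (M + 1) ^ m * (om (M + 1) * t))) (M + 1))
      (fusedL (M + 1) P M (om (M + 1) * (om (M + 1) * t)))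
      (fun k : Fin M => 1 - om (M + 1) ^ ((k : ℕ) + 1)) (qdet (M + 1) P t • weylX (M + 1))
      (classicalL (M + 1) P t) := by
  have hW := weyl (M + 1)
  have hgr := D_mul_coeff_symCol (N := M + 1) (P := P)
    (fun m => om (M + 1) ^ m * (om (M + 1) * t)) (M + 1)
  have hX : ∀ g : SiteOp (M + 1),
      g = weylX (M + 1) * (weylX (M + 1) ^ (M + 1 - 1) * g) := fun g => by
    rw [← mul_assoc, hW.XD, one_mul]
  constructor
  · intro k i
    set l : ℕ := (ends M i : ℕ) with hl
    have hlc : om (M + 1) ^ l = 1 ∧ l ≤ M + 1 ∧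
        C (weylX (M + 1) ^ (M + 1 - 1)) *
          symCol (fun m => lop (M + 1) P (om (M + 1) ^ m * (om (M + 1) * t))) (M + 1) l =
        symCol (fun m => lop (M + 1) P (om (M + 1) ^ m * (om (M + 1) * t))) (M + 1) l *
          C (weylX (M + 1) ^ (M + 1 - 1)) := by
      fin_cases i
      · simp only [Fin.zero_eta, val_ends_zero] at hl
        rw [hl]
        exact ⟨pow_zero _, by omega, D_mul_symCol_first hb t⟩
      · simp only [Fin.mk_one, val_ends_one] at hl
        rw [hl]
        exact ⟨om_pow _, le_rfl, D_mul_symCol_last hb t⟩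
    obtain ⟨h1, h2, h3⟩ := hlc
    -- The entry `g` satisfies `D g = g D` and, by the grading, `ω ^ (k + 1) D g = g D`.
    have h4 := congrArg (fun p => p.coeff ((k : ℕ) + 1)) h3
    simp only [coeff_C_mul, coeff_mul_C] at h4
    have h5 := hgr l ((k : ℕ) + 1) h2
    rw [h1, one_smul, ← h4] at h5
    have h6 : (1 - om (M + 1) ^ ((k : ℕ) + 1)) • (weylX (M + 1) ^ (M + 1 - 1) *
        (symCol (fun m => lop (M + 1) P (om (M + 1) ^ m * (om (M + 1) * t))) (M + 1) l).coeff
          ((k : ℕ) + 1)) = 0 := by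
      rw [sub_smul, h5, one_smul, sub_self]
    rw [symMat, val_mid, ← hl, hX (coeff _ _),
      (smul_eq_zero.1 h6).resolve_left (one_sub_om_pow_ne_zero k), mul_zero]
  · intro i j
    rw [← prodDown_lop hb hb']
    fin_cases i <;> fin_cases j <;>
      simp only [symMat, Fin.zero_eta, Fin.mk_one, val_ends_zero, val_ends_one,
        (coeff_symCol_first _ _).1, (coeff_symCol_first _ _).2, (coeff_symCol_last _ _).1,
        (coeff_symCol_last _ _).2]
  · intro k l
    obtain ⟨M, rfl⟩ : ∃ M', M = M' + 1 := ⟨M - 1, by have := k.isLt; omega⟩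
    have h1 := D_mul_symCol_mid (N := M + 1 + 1) hb hb' t (j := (l : ℕ)) (p := M - l) (by omega)
    have h2 := congrArg (fun p => p.coeff ((k : ℕ) + 1)) h1
    simp only [coeff_sub, coeff_smul, coeff_C_mul, coeff_mul_C, coeff_mul_X] at h2
    -- The grading turns the `ω`-commutator with `D` into multiplication by `(1 - ω ^ (k + 1)) D`.
    rw [← hgr (l + 1) (k + 1) (by omega), show (l : ℕ) + (M - l) = M by omega] at h2
    rw [symMat, val_mid, val_mid, hX (coeff _ _), fusedL_succ (exch_lop_seq hb hb' _), symMat]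
    have h3 := congrArg
      (fun A => (1 - om (M + 1 + 1) ^ ((k : ℕ) + 1))⁻¹ • (weylX (M + 1 + 1) * A)) h2
    rw [← one_smul ℂ (weylX (M + 1 + 1) ^ (M + 1 + 1 - 1) * _), smul_smul, mul_one,
      ← sub_smul] at h3
    simp only [mul_smul_comm, smul_smul] at h3
    rw [inv_mul_cancel₀ (one_sub_om_pow_ne_zero k), one_smul] at h3
    rw [h3, smul_mul_assoc, smul_smul, mul_assoc]

end Block

/-! ### The monodromy matrix -/

section Monodromy

variable {N : ℕ} [NeZero N] {L : ℕ} {P : Params}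

lemma monodromy_eq (t : ℂ) : monodromy N L P t = homChain (siteHoms N L) (lop N P t) :=
  chain_eq_homChain N L _

lemma exch_monodromy (hb : P.b ≠ 0) (hb' : P.b' ≠ 0) (s : ℂ) (m : ℕ) :
    Exch (monodromy N L P (om N ^ (m + 1) * s)) (monodromy N L P (om N ^ m * s))
      (zfun N L P (om N ^ m * s) • shiftX N L) := by
  rw [monodromy_eq, monodromy_eq, zfun, ← prod_siteHoms]
  exact exch_homChain (commImages_siteHoms N L) (exch_lop_seq hb hb' s m)

lemma chain_symMat_lop (hb : P.b ≠ 0) (hb' : P.b' ≠ 0) (s : ℂ) (n : ℕ) :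
    homChain (siteHoms N L) (symMat (fun m => lop N P (om N ^ m * s)) n) =
      symMat (fun m => monodromy N L P (om N ^ m * s)) n := by
  rw [homChain_symMat (commImages_siteHoms N L) (exch_lop_seq hb hb' s)]
  simp only [monodromy_eq]

lemma tau_succ (hb : P.b ≠ 0) (hb' : P.b' ≠ 0) (n : ℕ) (t : ℂ) :
    tau N L P (n + 1) t = ∑ l ∈ Finset.range (n + 1),
      (symCol (fun m => monodromy N L P (om N ^ m * (om N * t))) n l).coeff l := by
  rw [tau, fusedL_succ (exch_lop_seq hb hb' _), chain_eq_homChain, chain_symMat_lop hb hb',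
    trace_symMat]

lemma continuous_monodromy (i j : Fin 2) : Continuous fun t => monodromy N L P t i j := by
  have hlop : Continuous fun t => lop N P t := by
    refine continuous_matrix fun i j => ?_
    fin_cases i <;> fin_cases j <;>
      simp only [Fin.zero_eta, Fin.mk_one, lop_zero_zero, lop_zero_one, lop_one_zero,
        lop_one_one] <;>
      fun_prop
  have hsite : ∀ ℓ : Fin L, Continuous (site (N := N) ℓ) := fun ℓ =>
    (siteHom ℓ : SiteOp N →ₐ[ℂ] ChainOp N L).toLinearMap.continuous_of_finiteDimensional
  have h : Continuous fun t => monodromy N L P t := by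
    simp only [monodromy, chain, List.ofFn_eq_map]
    exact continuous_list_prod _ fun ℓ _ => hlop.matrix_map (hsite ℓ)
  exact h.matrix_elem i j

/-- The diagonal entries of the monodromy matrix commute for different values of the parameter. The
Yang–Baxter relation gives `(ω s - s') (A(s) A(s') - A(s') A(s)) = 0`, and the value `s = ω⁻¹ s'`
follows by continuity. -/
lemma commute_monodromy (i : Fin 2) (s s' : ℂ) :
    Commute (monodromy N L P s i i) (monodromy N L P s' i i) := by
  have hω := om_ne_zero N
  have h : ∀ s, s ≠ (om N)⁻¹ * s' →
      monodromy N L P s i i * monodromy N L P s' i i =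
        monodromy N L P s' i i * monodromy N L P s i i := by
    intro s hs
    have h1 := intertwine_homChain (commImages_siteHoms N L) (intertwine_lop (N := N) (P := P) s s')
    have h2 := congrFun (congrFun h1 (i, i)) (i, i)
    have hne : om N * s - s' ≠ 0 := by
      rw [sub_ne_zero]
      rintro rfl
      exact hs (by rw [inv_mul_cancel_left₀ hω])
    simp only [← monodromy_eq, Matrix.mul_apply, Fintype.sum_prod_type, Fin.sum_univ_two,
      Matrix.map_apply, Algebra.algebraMap_eq_smul_one, smul_mul_assoc, mul_smul_comm, one_mul,
      mul_one, tens] at h2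
    fin_cases i <;> simpa [rmat, hne] using h2
  have := Continuous.ext_on (dense_compl_singleton ((om N)⁻¹ * s'))
    ((continuous_monodromy (N := N) (L := L) (P := P) i i).mul continuous_const)
    (continuous_const.mul (continuous_monodromy (N := N) (L := L) (P := P) i i))
    (fun s hs => h s hs)
  exact congrFun this s

lemma average_eq_prodDown (i : Fin 2) (t : ℂ) :
    average N L (fun s => monodromy N L P s i i) t =
      prodDown (fun m => monodromy N L P (om N ^ m * (om N * t)) i i) N := by
  rw [average, prod_ofFn_eq_prodDown (f := fun m => monodromy N L P (om N ^ m * t) i i)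
    (fun _ _ => commute_monodromy i _ _) (by simp only [om_pow, pow_zero])]
  simp only [pow_succ, mul_assoc]

end Monodromy

end GenTau

theorem mainTheorem2 (N : ℕ) [NeZero N] (L : ℕ) (P : GenTau.Params)
    (ha : P.a ≠ 0) (hb : P.b ≠ 0) (ha' : P.a' ≠ 0) (hb' : P.b' ≠ 0) (hc : P.c ≠ 0) :
    -- the fusion matrices obey the initial values and the recursive fusion relation
    (∀ t : ℂ, GenTau.tau N L P 0 t = 0 ∧ GenTau.tau N L P 1 t = 1 ∧
      GenTau.tau N L P 2 t = GenTau.tau2 N L P t) ∧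
    (∀ j : ℕ, 1 ≤ j → ∀ t : ℂ,
      GenTau.tau2 N L P (GenTau.om N ^ (j - 1) * t) * GenTau.tau N L P j t =
        GenTau.zfun N L P (GenTau.om N ^ (j - 1) * t) •
          (GenTau.shiftX N L * GenTau.tau N L P (j - 1) t) + GenTau.tau N L P (j + 1) t) ∧
    -- the sum of the averages of `A_L` and `D_L` is the scalar operator `u(t) I`
    (∀ t : ℂ,
      GenTau.average N L (fun s => GenTau.monodromy N L P s 0 0) t +
        GenTau.average N L (fun s => GenTau.monodromy N L P s 1 1) t =
          GenTau.ufun N L P t • (1 : GenTau.ChainOp N L)) ∧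
    -- the boundary fusion relation
    (∀ t : ℂ,
      GenTau.tau N L P (N + 1) t =
        GenTau.zfun N L P t •
          (GenTau.shiftX N L * GenTau.tau N L P (N - 1) (GenTau.om N * t)) +
        GenTau.ufun N L P t • (1 : GenTau.ChainOp N L)) := by
  open GenTau in
  have h0 : ∀ t, tau N L P 0 t = 0 := fun t => by simp [tau, Matrix.trace]
  have h1 : ∀ t, tau N L P 1 t = 1 := fun t => by
    rw [tau_succ hb hb']
    simp [symCol]
  have h2 : ∀ t, tau N L P 2 t = tau2 N L P t := fun t => by
    rw [tau_succ hb hb', Finset.sum_range_succ, Finset.sum_range_one, (coeff_symCol_first _ _).1,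
      (coeff_symCol_last _ 1).2]
    simp [prodDown, tau2, Matrix.trace]
  obtain ⟨M, rfl⟩ : ∃ M, N = M + 1 := ⟨N - 1, (Nat.sub_add_cancel NeZero.one_le).symm⟩
  have hblock := fun t => (blockTri_lop (M := M) hb hb' t).homChain (commImages_siteHoms (M + 1) L)
    one_sub_om_pow_ne_zero
  simp only [length_siteHoms, prod_siteHoms, chain_symMat_lop hb hb'] at hblock
  refine ⟨fun t => ⟨h0 t, h1 t, h2 t⟩, ?_, ?_, ?_⟩
  · intro j hj t
    obtain ⟨m, rfl⟩ | rfl : (∃ m, j = m + 2) ∨ j = 1 := by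
      rcases hj.lt_or_eq with h | h
      · exact Or.inl ⟨j - 2, by omega⟩
      · exact Or.inr h.symm
    · have h := trace_mul_sum_symCol
        (K := fun m => monodromy (M + 1) L P (om (M + 1) ^ m * (om (M + 1) * t)))
        (exch_monodromy hb hb' _) m
      have e : ∀ m, om (M + 1) ^ m * (om (M + 1) * t) = om (M + 1) ^ (m + 1) * t := fun m => by ring
      rw [e m, smul_mul_assoc] at h
      rw [show m + 2 - 1 = m + 1 from rfl, tau_succ hb hb' (m + 1), tau_succ hb hb' m,
        tau_succ hb hb' (m + 2), tau2, Matrix.trace_fin_two, mul_left_comm]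
      exact h
    · rw [h1, h0, h2]
      simp
  · intro t
    rw [average_eq_prodDown, average_eq_prodDown]
    have e0 := (hblock t).ends_ends 0 0
    have e1 := (hblock t).ends_ends 1 1
    rw [symMat, val_ends_zero, (coeff_symCol_first _ _).1] at e0
    rw [symMat, val_ends_one, (coeff_symCol_last _ _).2] at e1
    rw [e0, e1, Algebra.algebraMap_eq_smul_one, Algebra.algebraMap_eq_smul_one, ← add_smul, ufun,
      Matrix.trace_fin_two]
  · intro t
    have h := (hblock t).trace one_sub_om_pow_ne_zero
    rw [tau_succ hb hb', ← trace_symMat, h, smul_mul_assoc, tau, chain_eq_homChain]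
    rfl

end
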